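/- All spaces are finite dimensional and complex, $\mathbb{C}^m\otimes\mathbb{C}^n=\mathcal H_A\otimes\mathcal H_B$, and $|i,j\rangle$ is the product of computational basis vectors (numbered from $0$). For $k\le n$ we regard $\mathbb{C}^m\otimes\mathbb{C}^k$ as a subspace of $\mathbb{C}^m\otimes\mathbb{C}^n$ in the standard way. A subspace $V\subseteq\mathbb{C}^m\otimes\mathbb{C}^n$ is an \emph{entanglement-breaking (EB) space} if for all systems $a,b$ and every $|\Psi\rangle\in V\otimes\mathcal H_{ab}$ the operator $\mathrm{Tr}_B|\Psi\rangle\langle\Psi|$ is separable with respect to $A:ab$, i.e. of the form $\sum_s q_s|\mu_s\rangle\langle\mu_s|_A\otimes|\nu_s\rangle\langle\nu_s|_{ab}$ with $q_s\ge0$ (finite sum). $V$ is \emph{EB convertible} to $V'$ if $V'=(W\otimes U)V$ for some (possibly rectangular) matrix $W$ and some unitary $U$; $V$ and $V'$ are \emph{EB equivalent} if moreover $W$ can be chosen invertible. Two subspaces $S,T$ of $\mathbb{C}^m\otimes\mathbb{C}^n$ of equal dimension are \emph{LU equivalent} if a product unitary $U_A\otimes U_B$ maps every vector of $S$ into $T$.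 The \emph{$B$-rank} of $V$ is the dimension of the smallest subspace $S\subseteq\mathbb{C}^n$ with $V\subseteq\mathbb{C}^m\otimes S$. (1) Every $2$-dimensional EB subspace $V\subseteq\mathbb{C}^2\otimes\mathbb{C}^n$ is LU equivalent to an EB subspace $T$ of $\mathbb{C}^2\otimes\mathbb{C}^k$ of $B$-rank $k$, for some $k\in\{2,3,4\}$ with $k\le n$. (2) Let $k\in\{2,3\}$ and let $T\subseteq\mathbb{C}^2\otimes\mathbb{C}^k\subseteq\mathbb{C}^2\otimes\mathbb{C}^3$ be a $2$-dimensional subspace. Then $T$ is an EB space if and only if one of the following subspaces of $\mathbb{C}^3\otimes\mathbb{C}^3$ is EB convertible to $T$ (regarded in $\mathbb{C}^2\otimes\mathbb{C}^3$): $$\mathrm{span}\{|0,0\rangle,\ |1,1\rangle+|2,2\rangle\},\qquad \mathrm{span}\{|0,0\rangle+|1,1\rangle,\ |1,1\rangle+|2,2\rangle\},$$ $$\mathrm{span}\{|0,0\rangle+|1,1\rangle,\ |0,1\rangle+|1\rangle(d|0\rangle+fe^{i\theta}|1\rangle+g|2\rangle)\},$$ where $g>0$ and $d,f,\theta\ge0$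 are real numbers with $-1-f^2+g^2-d^2(-2+d^2+f^2+g^2)+2df^2\cos2\theta\ge0$. (3) Let $T\subseteq\mathbb{C}^2\otimes\mathbb{C}^4$ be a subspace. Then $T$ is a $2$-dimensional EB space of $B$-rank $4$ if and only if $T$ is EB equivalent to the span of the two vectors $$|0,0\rangle+b_0(a_0|0\rangle+a_1|1\rangle)|2\rangle+d_0(c_0|0\rangle+c_1|1\rangle)|3\rangle,$$ $$|1,1\rangle+b_1(a_0|0\rangle+a_1|1\rangle)|2\rangle+d_1(c_0|0\rangle+c_1|1\rangle)|3\rangle$$ for some complex numbers $a_j,b_j,c_j,d_j$ ($j=0,1$) with $$\det\begin{bmatrix}a_0b_1&a_1b_0\\c_0d_1&c_1d_0\end{bmatrix}\ne0.$$ -/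

import Mathlib

open scoped Matrix Kronecker

noncomputable section

namespace EBSpace

/-- The vector space `ℂ^m ⊗ ℂ^n` (system `A` first, system `B` second), in coordinates. -/
abbrev Bip (m n : ℕ) : Type := Fin m × Fin n → ℂ

/-- The computational product basis vector `|i, j⟩`. -/
def ket {m n : ℕ} (i : Fin m) (j : Fin n) : Bip m n := Pi.single (i, j) 1

/-- The (unnormalized) rank-one operator `|v⟩⟨v|`. -/
def proj {ι : Type*} (v : ι → ℂ) : Matrix ι ι ℂ := Matrix.vecMulVec v (star v)

/-- `V ⊗ ℂ^κ`, as the span of the product vectors `v ⊗ w` with `v ∈ V`. -/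
def tensorRight {ι κ : Type*} (V : Submodule ℂ (ι → ℂ)) : Submodule ℂ (ι × κ → ℂ) :=
  Submodule.span ℂ {Ψ | ∃ v ∈ V, ∃ w : κ → ℂ, Ψ = fun x => v x.1 * w x.2}

/-- A vector lies in `V ⊗ ℂ^κ` iff all its slices lie in `V`. -/
theorem mem_tensorRight_iff {ι κ : Type*} [Fintype κ] [DecidableEq κ]
    (V : Submodule ℂ (ι → ℂ)) (Ψ : ι × κ → ℂ) :
    Ψ ∈ tensorRight V ↔ ∀ k, (fun i => Ψ (i, k)) ∈ V := by
  constructor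
  · intro h k
    induction h using Submodule.span_induction with
    | mem x hx =>
      obtain ⟨v, hv, w, rfl⟩ := hx
      have := V.smul_mem (w k) hv
      convert this using 1
      ext i
      simp [mul_comm]
    | zero => exact V.zero_mem
    | add x y _ _ hx hy => exact V.add_mem hx hy
    | smul c x _ hx => exact V.smul_mem c hx
  · intro h
    have hsum : Ψ = ∑ k, fun x : ι × κ => Ψ (x.1, k) * (Pi.single k (1 : ℂ) : κ → ℂ) x.2 := by
      ext ⟨i, k⟩
      simp [Finset.sum_apply, Pi.single_apply]
    rw [hsum]
    exact Submodule.sum_mem _ fun k _ => Submodule.subset_span ⟨_, h k, _, rfl⟩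

/-- The partial trace over the middle system `B` of an operator on `(A ⊗ B) ⊗ C`;
the result is an operator on `A ⊗ C`. -/
def traceB {α β γ : Type*} [Fintype β] (M : Matrix ((α × β) × γ) ((α × β) × γ) ℂ) :
    Matrix (α × γ) (α × γ) ℂ :=
  Matrix.of fun x y => ∑ j, M ((x.1, j), x.2) ((y.1, j), y.2)

/-- Separability of a bipartite (not necessarily normalized) positive operator:
it is a finite sum `∑ qₙ |μₙ⟩⟨μₙ| ⊗ |νₙ⟩⟨νₙ|` with `qₙ ≥ 0`. -/
def IsSeparable {α γ : Type*} (ρ : Matrix (α × γ) (α × γ) ℂ) : Prop :=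
  ∃ (N : ℕ) (q : Fin N → ℝ) (μ : Fin N → α → ℂ) (ν : Fin N → γ → ℂ),
    (∀ s, 0 ≤ q s) ∧ ρ = ∑ s, (q s : ℂ) • (proj (μ s) ⊗ₖ proj (ν s))

/-- `V ⊆ ℂ^m ⊗ ℂ^n` is an entanglement-breaking space: for all systems `a = ℂ^p`, `b = ℂ^q`
and every `Ψ ∈ V ⊗ (a ⊗ b)`, tracing out `B` leaves a state separable between `A` and `ab`.
Vectors are not normalized; separability as defined above is insensitive to scaling. -/
def IsEB {m n : ℕ} (V : Submodule ℂ (Bip m n)) : Prop :=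
  ∀ (p q : ℕ) (Ψ : (Fin m × Fin n) × (Fin p × Fin q) → ℂ),
    Ψ ∈ tensorRight V → IsSeparable (traceB (proj Ψ))

/-- The image of `V` under the product operator `W ⊗ U`. -/
def image {m m' n n' : ℕ} (W : Matrix (Fin m') (Fin m) ℂ) (U : Matrix (Fin n') (Fin n) ℂ)
    (V : Submodule ℂ (Bip m n)) : Submodule ℂ (Bip m' n') :=
  V.map (W ⊗ₖ U).mulVecLin

/-- `V` is EB-convertible to `V'`: `V' = (W ⊗ U) V` for a matrix `W` and a unitary `U`. -/
def EBConvertible {m m' n : ℕ} (V : Submodule ℂ (Bip m n)) (V' : Submodule ℂ (Bip m' n)) :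
    Prop :=
  ∃ (W : Matrix (Fin m') (Fin m) ℂ) (U : Matrix (Fin n) (Fin n) ℂ),
    U ∈ Matrix.unitaryGroup (Fin n) ℂ ∧ V' = image W U V

/-- `V` and `V'` are EB-equivalent: `V' = (W ⊗ U) V` with `W` invertible and `U` unitary. -/
def EBEquivalent {m n : ℕ} (V V' : Submodule ℂ (Bip m n)) : Prop :=
  ∃ (W : Matrix (Fin m) (Fin m) ℂ) (U : Matrix (Fin n) (Fin n) ℂ),
    IsUnit W ∧ U ∈ Matrix.unitaryGroup (Fin n) ℂ ∧ V' = image W U V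

/-- `S` and `T` are LU equivalent: they have the same dimension and a product unitary maps
every vector of `S` into `T`. -/
def LUEquivalent {m n : ℕ} (S T : Submodule ℂ (Bip m n)) : Prop :=
  Module.finrank ℂ S = Module.finrank ℂ T ∧
  ∃ (W : Matrix (Fin m) (Fin m) ℂ) (U : Matrix (Fin n) (Fin n) ℂ),
    W ∈ Matrix.unitaryGroup (Fin m) ℂ ∧ U ∈ Matrix.unitaryGroup (Fin n) ℂ ∧
    ∀ a ∈ S, (W ⊗ₖ U) *ᵥ a ∈ T

/-- The inclusion `ℂ^m ⊗ ℂ^k ⊆ ℂ^m ⊗ ℂ^n` for `k ≤ n`, `|i, j⟩ ↦ |i, j⟩`. -/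
def embedB {m k n : ℕ} (_hk : k ≤ n) : Bip m k →ₗ[ℂ] Bip m n where
  toFun v x := if h : (x.2 : ℕ) < k then v (x.1, ⟨x.2, h⟩) else 0
  map_add' v w := by
    ext x
    by_cases h : (x.2 : ℕ) < k <;> simp [h]
  map_smul' c v := by
    ext x
    by_cases h : (x.2 : ℕ) < k <;> simp [h]

/-- The inclusion sends product basis vectors to product basis vectors. -/
theorem embedB_ket {m k n : ℕ} (hk : k ≤ n) (i : Fin m) (j : Fin k) :
    embedB hk (ket i j) = ket i (Fin.castLE hk j) := by
  ext ⟨a, b⟩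
  by_cases h : (b : ℕ) < k
  · simp [embedB, ket, Pi.single_apply, h, Fin.ext_iff]
  · have : (b : ℕ) ≠ j := by omega
    simp [embedB, ket, h, Fin.ext_iff, this]

/-- The local support of `V` on system `B`: the smallest subspace `S ⊆ ℂ^n` such that
`V ⊆ ℂ^m ⊗ S`. -/
def supportB {m n : ℕ} (V : Submodule ℂ (Bip m n)) : Submodule ℂ (Fin n → ℂ) :=
  Submodule.span ℂ {w | ∃ v ∈ V, ∃ i, w = fun j => v (i, j)}

/-- The local rank of `V` on system `B`. -/
def rankB {m n : ℕ} (V : Submodule ℂ (Bip m n)) : ℕ := Module.finrank ℂ (supportB V)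

/-- The three kinds of two-dimensional model spaces in `ℂ^3 ⊗ ℂ^3`. -/
def IsModel3 (S : Submodule ℂ (Bip 3 3)) : Prop :=
  S = Submodule.span ℂ {ket 0 0, ket 1 1 + ket 2 2} ∨
  S = Submodule.span ℂ {ket 0 0 + ket 1 1, ket 1 1 + ket 2 2} ∨
  ∃ d f θ g : ℝ, 0 ≤ d ∧ 0 ≤ f ∧ 0 ≤ θ ∧ 0 < g ∧
    0 ≤ -1 - f ^ 2 + g ^ 2 - d ^ 2 * (-2 + d ^ 2 + f ^ 2 + g ^ 2)
      + 2 * d * f ^ 2 * Real.cos (2 * θ) ∧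
    S = Submodule.span ℂ
      {ket 0 0 + ket 1 1,
       ket 0 1 + ((d : ℂ) • ket 1 0 + ((f : ℂ) * Complex.exp (Complex.I * (θ : ℂ))) • ket 1 1
        + (g : ℂ) • ket 1 2)}

/-- The model space in `ℂ^2 ⊗ ℂ^4` spanned by
`|j,j⟩ + b_j (a_0|0⟩ + a_1|1⟩)|2⟩ + d_j (c_0|0⟩ + c_1|1⟩)|3⟩` for `j = 0, 1`. -/
def model4 (a b c d : Fin 2 → ℂ) : Submodule ℂ (Bip 2 4) :=
  Submodule.span ℂ
    {ket 0 0 + b 0 • (a 0 • ket 0 2 + a 1 • ket 1 2) + d 0 • (c 0 • ket 0 3 + c 1 • ket 1 3),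
     ket 1 1 + b 1 • (a 0 • ket 0 2 + a 1 • ket 1 2) + d 1 • (c 0 • ket 0 3 + c 1 • ket 1 3)}

end EBSpace

end

/-! A basis of a two-dimensional `V` turns it into 2×2 matrices `M j`, one for each basis vector of
B. A matrix on A multiplies them on the left, a change of basis of `V` multiplies them on the right,
and a unitary on B recombines them. `V` is EB iff `∑ |M j⟩⟨M j|` is separable (`isEB_ofSlices`):
every other input arises from this state by a linear map on the reference, which preserves product
vectors.

A 2×2 matrix is a product vector iff its determinant vanishes, so the relevant invariant is the Gram
matrix of the polarized determinant. It is complex symmetric and becomes `U * gram M * Uᵀ` under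
recombination, so Takagi's factorization makes it diagonal with entries `l i ≥ 0`. Separability
forces the polygon inequalities `2 * l i ≤ ∑ j, l j` (`two_mul_le_sum_of_isSeparable`), as in
Wootters' concurrence criterion.

Four slices: the lengths `l i` close up to a quadrilateral, and its phases followed by a Hadamard
matrix make all slices products. At B-rank 4 two of these products can be normalized to `|0,0⟩` and
`|1,1⟩`, which gives `model4`.

Three slices, singular Gram matrix: the lengths are `l, l, 0`, and again all slices become products.
Only the relative position of the three reference vectors in `ℂ^2` matters: two parallel, or all
pairwise independent. These are the first two models.

Three slices, invertible Gram matrix: the slices become symmetric after a right multiplication,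
triangular after a unitary, and equal to `triSlices` after a congruence and phases. For `triSlices`
the inequality says that the partial transpose has nonnegative determinant, hence is necessary. It
is sufficient because the state is a sum of four terms `H ⊗ H` with `H` Hermitian and total
determinant 0, which rotations turn into four singular ones. -/

namespace EBSpace

/-! ### Slices of a subspace and the associated state -/

/-- The subspace spanned by the vectors `∑ M j a c |a, j⟩`, one for every column index `c`. -/
def ofSlices {m n r : ℕ} (M : Fin n → Matrix (Fin m) (Fin r) ℂ) : Submodule ℂ (Bip m n) :=
  Submodule.span ℂ (Set.range fun c x => M x.2 x.1 c)

/-- Recombination of a family of matrices by the coefficients of `U`. -/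
def mix {n n' : ℕ} {α β : Type*} (U : Matrix (Fin n') (Fin n) ℂ) (M : Fin n → Matrix α β ℂ) :
    Fin n' → Matrix α β ℂ :=
  fun j => ∑ k, U j k • M k

/-- The operator `∑ |M j⟩⟨M j|`. -/
def slicesState {n : ℕ} {α β : Type*} (M : Fin n → Matrix α β ℂ) : Matrix (α × β) (α × β) ℂ :=
  ∑ j, proj fun x => M j x.1 x.2

theorem mix_apply {n n' : ℕ} {α β : Type*} (U : Matrix (Fin n') (Fin n) ℂ)
    (M : Fin n → Matrix α β ℂ) (j : Fin n') (a : α) (c : β) :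
    mix U M j a c = ∑ k, U j k * M k a c := by
  simp [mix, Matrix.sum_apply]

theorem mix_mix {n n' n'' : ℕ} {α β : Type*} (U : Matrix (Fin n'') (Fin n') ℂ)
    (U' : Matrix (Fin n') (Fin n) ℂ) (M : Fin n → Matrix α β ℂ) :
    mix U (mix U' M) = mix (U * U') M := by
  ext j a c
  simp only [mix_apply, Matrix.mul_apply, Finset.mul_sum, Finset.sum_mul]
  rw [Finset.sum_comm]
  simp only [mul_assoc]

theorem mix_one {n : ℕ} {α β : Type*} (M : Fin n → Matrix α β ℂ) : mix 1 M = M := by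
  ext j a c
  simp [mix_apply, Matrix.one_apply]

theorem mix_mul {n n' : ℕ} {α β γ : Type*} [Fintype β] (R : Matrix β γ ℂ)
    (U : Matrix (Fin n') (Fin n) ℂ) (M : Fin n → Matrix α β ℂ) (j : Fin n') :
    mix U M j * R = mix U (fun k => M k * R) j := by
  simp [mix, Matrix.sum_mul]

theorem slicesState_apply {n : ℕ} {α β : Type*} (M : Fin n → Matrix α β ℂ) (x y : α × β) :
    slicesState M x y = ∑ j, M j x.1 x.2 * star (M j y.1 y.2) := by
  simp [slicesState, proj, Matrix.sum_apply, Matrix.vecMulVec_apply]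

theorem image_ofSlices {m m' n n' r : ℕ} (W : Matrix (Fin m') (Fin m) ℂ)
    (U : Matrix (Fin n') (Fin n) ℂ) (M : Fin n → Matrix (Fin m) (Fin r) ℂ) :
    image W U (ofSlices M) = ofSlices fun j => W * mix U M j := by
  rw [image, ofSlices, ofSlices, Submodule.map_span, ← Set.range_comp]
  congr 2
  ext c ⟨a, j⟩
  simp only [Function.comp, Matrix.mulVecLin_apply, Matrix.mulVec, dotProduct,
    Matrix.kroneckerMap_apply, Fintype.sum_prod_type, Matrix.mul_apply, mix_apply, Finset.mul_sum,
    mul_assoc]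

theorem image_image {m m' m'' n n' n'' : ℕ} (W' : Matrix (Fin m'') (Fin m') ℂ)
    (U' : Matrix (Fin n'') (Fin n') ℂ) (W : Matrix (Fin m') (Fin m) ℂ)
    (U : Matrix (Fin n') (Fin n) ℂ) (V : Submodule ℂ (Bip m n)) :
    image W' U' (image W U V) = image (W' * W) (U' * U) V := by
  rw [image, image, image, ← Submodule.map_comp, ← Matrix.mulVecLin_mul,
    Matrix.mul_kronecker_mul]

theorem image_one {m n : ℕ} (V : Submodule ℂ (Bip m n)) : image 1 1 V = V := by
  simp [image]

theorem ofSlices_mul_le {m n r s : ℕ} (M : Fin n → Matrix (Fin m) (Fin r) ℂ)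
    (R : Matrix (Fin r) (Fin s) ℂ) : ofSlices (fun j => M j * R) ≤ ofSlices M := by
  rw [ofSlices, Submodule.span_le]
  rintro _ ⟨c, rfl⟩
  have : (fun x : Fin m × Fin n => (M x.2 * R) x.1 c)
      = ∑ k, R k c • fun x : Fin m × Fin n => M x.2 x.1 k := by
    ext x
    simp [Matrix.mul_apply, Finset.sum_apply, mul_comm]
  change (fun x : Fin m × Fin n => (M x.2 * R) x.1 c) ∈ _
  rw [this]
  exact Submodule.sum_mem _ fun k _ => Submodule.smul_mem _ _ (Submodule.subset_span ⟨k, rfl⟩)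

theorem ofSlices_mul {m n r : ℕ} (M : Fin n → Matrix (Fin m) (Fin r) ℂ)
    (R : Matrix (Fin r) (Fin r) ℂ) (hR : IsUnit R.det) :
    ofSlices (fun j => M j * R) = ofSlices M := by
  refine le_antisymm (ofSlices_mul_le M R) ?_
  have := ofSlices_mul_le (fun j => M j * R) R⁻¹
  simpa [Matrix.mul_nonsing_inv_cancel_right _ _ hR] using this

theorem exists_eq_ofSlices {m n r : ℕ} (V : Submodule ℂ (Bip m n))
    (hV : Module.finrank ℂ V = r) :
    ∃ M : Fin n → Matrix (Fin m) (Fin r) ℂ, V = ofSlices M ∧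
      LinearIndependent ℂ fun (c : Fin r) (x : Fin m × Fin n) => M x.2 x.1 c := by
  let b := (Module.finBasis ℂ V).reindex (finCongr hV)
  refine ⟨fun j => Matrix.of fun a c => (b c : Bip m n) (a, j), ?_, ?_⟩
  · have h := congrArg (Submodule.map V.subtype) b.span_eq
    rw [Submodule.map_span, ← Set.range_comp, Submodule.map_top, Submodule.range_subtype] at h
    exact h.symm
  · exact b.linearIndependent.map' V.subtype (Submodule.ker_subtype V)

theorem finrank_ofSlices {m n r : ℕ} {M : Fin n → Matrix (Fin m) (Fin r) ℂ}
    (hM : LinearIndependent ℂ fun (c : Fin r) (x : Fin m × Fin n) => M x.2 x.1 c) :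
    Module.finrank ℂ (ofSlices M) = r := by
  rw [ofSlices, finrank_span_eq_card hM, Fintype.card_fin]

theorem linearIndependent_of_finrank_ofSlices {m n r : ℕ} {M : Fin n → Matrix (Fin m) (Fin r) ℂ}
    (hM : Module.finrank ℂ (ofSlices M) = r) :
    LinearIndependent ℂ fun (c : Fin r) (x : Fin m × Fin n) => M x.2 x.1 c := by
  rw [linearIndependent_iff_card_eq_finrank_span, Fintype.card_fin]
  exact hM.symm

/-- A separable operator is a sum of projectors onto product vectors. -/
theorem isSeparable_iff {α γ : Type*} {ρ : Matrix (α × γ) (α × γ) ℂ} :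
    IsSeparable ρ ↔ ∃ (N : ℕ) (μ : Fin N → α → ℂ) (ν : Fin N → γ → ℂ),
      ρ = slicesState fun s => Matrix.vecMulVec (μ s) (ν s) := by
  constructor
  · rintro ⟨N, q, μ, ν, hq, rfl⟩
    refine ⟨N, fun s => (Real.sqrt (q s) : ℂ) • μ s, ν, ?_⟩
    ext x y
    rw [slicesState_apply, Matrix.sum_apply]
    refine Finset.sum_congr rfl fun s _ => ?_
    have h : (q s : ℂ) = (Real.sqrt (q s) : ℂ) * (Real.sqrt (q s) : ℂ) := by
      rw [← Complex.ofReal_mul, Real.mul_self_sqrt (hq s)]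
    simp only [proj, Matrix.smul_apply, Matrix.kroneckerMap_apply, Matrix.vecMulVec_apply,
      Pi.star_apply, smul_eq_mul, Pi.smul_apply, star_mul', RCLike.star_def, Complex.conj_ofReal]
    rw [h]
    ring
  · rintro ⟨N, μ, ν, rfl⟩
    refine ⟨N, fun _ => 1, μ, ν, fun _ => zero_le_one, ?_⟩
    ext x y
    rw [slicesState_apply, Matrix.sum_apply]
    refine Finset.sum_congr rfl fun s _ => ?_
    simp only [proj, Matrix.smul_apply, Matrix.kroneckerMap_apply, Matrix.vecMulVec_apply,
      Pi.star_apply, smul_eq_mul, star_mul', Complex.ofReal_one]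
    ring

/-- The state is the output for the input `∑ v_c ⊗ |c⟩`, with `a = ℂ^r` and `b` trivial. Any other
vector of `V ⊗ ab` is the image of this one under a linear map on the reference, and such a map
sends product vectors to product vectors. -/
theorem isEB_ofSlices {m n r : ℕ} {M : Fin n → Matrix (Fin m) (Fin r) ℂ} :
    IsEB (ofSlices M) ↔ IsSeparable (slicesState M) := by
  constructor
  · intro h
    have h' := h r 1 (fun x => M x.1.2 x.1.1 x.2.1) (by
      rw [mem_tensorRight_iff]
      exact fun k => Submodule.subset_span ⟨k.1, rfl⟩)
    rw [isSeparable_iff] at h' ⊢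
    obtain ⟨N, μ, ν, hN⟩ := h'
    refine ⟨N, μ, fun s c => ν s (c, 0), ?_⟩
    ext x y
    have := congrFun (congrFun hN (x.1, (x.2, 0))) (y.1, (y.2, 0))
    rw [slicesState_apply] at this ⊢
    simpa [slicesState_apply, traceB, proj, Matrix.vecMulVec_apply] using this
  · intro h p q Ψ hΨ
    rw [mem_tensorRight_iff] at hΨ
    have hw : ∀ k, ∃ w : Fin r → ℂ, ∑ c, w c • (fun x : Fin m × Fin n => M x.2 x.1 c)
        = fun i => Ψ (i, k) := fun k => (Submodule.mem_span_range_iff_exists_fun ℂ).1 (hΨ k)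
    choose w hw using hw
    have hΨ' : ∀ a j k, Ψ ((a, j), k) = ∑ c, M j a c * w k c := fun a j k => by
      have := congrFun (hw k) (a, j)
      simpa [Finset.sum_apply, mul_comm] using this.symm
    rw [isSeparable_iff] at h ⊢
    obtain ⟨N, μ, ν, hN⟩ := h
    refine ⟨N, μ, fun s k => ∑ c, ν s c * w k c, ?_⟩
    ext ⟨a, k⟩ ⟨a', k'⟩
    have key : ∀ c c', ∑ j, M j a c * star (M j a' c')
        = ∑ s, (μ s a * ν s c) * star (μ s a' * ν s c') := fun c c' => by
      have := congrFun (congrFun hN (a, c)) (a', c')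
      simpa only [slicesState_apply, Matrix.vecMulVec_apply] using this
    -- Both sides depend on their families only through the second moments compared in `key`; this
    -- expansion serves the slices and the product vectors alike.
    have e1 : ∀ {ι : Type} [Fintype ι] (f g : ι → Fin r → ℂ),
        ∑ j, (∑ c, f j c * w k c) * star (∑ c, g j c * w k' c)
          = ∑ c, ∑ c', (∑ j, f j c * star (g j c')) * (w k c * star (w k' c')) := by
      intro ι _ f g
      simp only [star_sum, star_mul']
      simp only [Finset.sum_mul_sum]
      simp only [Finset.sum_mul]
      rw [Finset.sum_comm]
      refine Finset.sum_congr rfl fun c _ => ?_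
      rw [Finset.sum_comm]
      refine Finset.sum_congr rfl fun c' _ => Finset.sum_congr rfl fun j _ => ?_
      ring
    have e2 : ∀ s a, μ s a * ∑ c, ν s c * w k c = ∑ c, (μ s a * ν s c) * w k c := fun s a => by
      rw [Finset.mul_sum]; simp only [mul_assoc]
    have e3 : ∀ s a, μ s a * ∑ c, ν s c * w k' c = ∑ c, (μ s a * ν s c) * w k' c := fun s a => by
      rw [Finset.mul_sum]; simp only [mul_assoc]
    rw [slicesState_apply]
    simp only [traceB, proj, Matrix.of_apply, Matrix.vecMulVec_apply, Pi.star_apply, hΨ', e2, e3]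
    rw [e1 (fun j c => M j a c) (fun j c => M j a' c),
      e1 (fun s c => μ s a * ν s c) (fun s c => μ s a' * ν s c)]
    simp only [key]

theorem slicesState_mix {n : ℕ} {α β : Type*} {U : Matrix (Fin n) (Fin n) ℂ}
    (hU : U ∈ Matrix.unitaryGroup (Fin n) ℂ) (M : Fin n → Matrix α β ℂ) :
    slicesState (mix U M) = slicesState M := by
  have h := Matrix.mem_unitaryGroup_iff'.1 hU
  have h' : ∀ k l, ∑ j, star (U j k) * U j l = if k = l then 1 else 0 := fun k l => by
    have := congrFun (congrFun h k) l
    rwa [Matrix.mul_apply, Matrix.one_apply] at this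
  ext x y
  simp only [slicesState_apply, mix_apply, star_sum, star_mul', Finset.sum_mul_sum]
  rw [Finset.sum_comm]
  calc _ = ∑ k, ∑ l, (∑ j, star (U j l) * U j k) * (M k x.1 x.2 * star (M l y.1 y.2)) := by
        refine Finset.sum_congr rfl fun k _ => ?_
        rw [Finset.sum_comm]
        refine Finset.sum_congr rfl fun l _ => ?_
        rw [Finset.sum_mul]
        exact Finset.sum_congr rfl fun j _ => by ring
    _ = _ := by simp only [h']; simp

theorem isSeparable_slicesState_mul {n : ℕ} {α β γ : Type*} [Fintype α]
    (W : Matrix γ α ℂ) {M : Fin n → Matrix α β ℂ} (hM : IsSeparable (slicesState M)) :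
    IsSeparable (slicesState fun j => W * M j) := by
  rw [isSeparable_iff] at hM ⊢
  obtain ⟨N, μ, ν, hN⟩ := hM
  refine ⟨N, fun s => W *ᵥ μ s, ν, ?_⟩
  have e : ∀ {k : ℕ} (f : Fin k → Matrix α β ℂ) x y, slicesState (fun j => W * f j) x y
      = ∑ a, ∑ b, W x.1 a * star (W y.1 b) * slicesState f (a, x.2) (b, y.2) := by
    intro k f x y
    simp only [slicesState_apply, Matrix.mul_apply, star_sum, star_mul']
    simp only [Finset.sum_mul_sum]
    simp only [Finset.mul_sum]
    rw [Finset.sum_comm]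
    refine Finset.sum_congr rfl fun a _ => ?_
    rw [Finset.sum_comm]
    refine Finset.sum_congr rfl fun b _ => Finset.sum_congr rfl fun j _ => ?_
    ring
  have e' : (fun s => Matrix.vecMulVec (W *ᵥ μ s) (ν s))
      = fun s => W * Matrix.vecMulVec (μ s) (ν s) := by
    funext s
    rw [Matrix.mul_vecMulVec]
  ext x y
  rw [e', e, e, hN]

theorem IsEB.image {m m' n : ℕ} {V : Submodule ℂ (Bip m n)} (hV : IsEB V)
    (W : Matrix (Fin m') (Fin m) ℂ) {U : Matrix (Fin n) (Fin n) ℂ}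
    (hU : U ∈ Matrix.unitaryGroup (Fin n) ℂ) : IsEB (image W U V) := by
  obtain ⟨r, hr⟩ : ∃ r, Module.finrank ℂ V = r := ⟨_, rfl⟩
  obtain ⟨M, rfl, -⟩ := exists_eq_ofSlices V hr
  rw [image_ofSlices]
  rw [isEB_ofSlices] at hV ⊢
  exact isSeparable_slicesState_mul W (by rwa [slicesState_mix hU])

theorem isEB_ofSlices_vecMulVec {m n r : ℕ} (μ : Fin n → Fin m → ℂ) (ν : Fin n → Fin r → ℂ) :
    IsEB (ofSlices fun j => Matrix.vecMulVec (μ j) (ν j)) :=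
  isEB_ofSlices.2 (isSeparable_iff.2 ⟨n, μ, ν, rfl⟩)

theorem embedB_injective {m k n : ℕ} (hk : k ≤ n) :
    Function.Injective (embedB hk : Bip m k →ₗ[ℂ] Bip m n) := by
  intro v w h
  ext ⟨a, j⟩
  simpa [embedB] using congrFun h (a, Fin.castLE hk j)

theorem map_embedB_ofSlices {m k n r : ℕ} (hk : k ≤ n) (M : Fin k → Matrix (Fin m) (Fin r) ℂ) :
    (ofSlices M).map (embedB hk)
      = ofSlices fun j : Fin n => if h : (j : ℕ) < k then M ⟨j, h⟩ else 0 := by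
  rw [ofSlices, ofSlices, Submodule.map_span, ← Set.range_comp]
  congr 2
  ext c ⟨a, j⟩
  by_cases h : (j : ℕ) < k <;> simp [embedB, h]

theorem slicesState_pad {k n : ℕ} {α β : Type*} (hk : k ≤ n) (M : Fin k → Matrix α β ℂ) :
    (slicesState fun j : Fin n => if h : (j : ℕ) < k then M ⟨j, h⟩ else 0) = slicesState M := by
  obtain ⟨l, rfl⟩ := Nat.exists_eq_add_of_le hk
  ext x y
  simp [slicesState_apply, Fin.sum_univ_add]

theorem isEB_map_embedB {m k n : ℕ} (hk : k ≤ n) (T : Submodule ℂ (Bip m k)) :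
    IsEB (T.map (embedB hk)) ↔ IsEB T := by
  obtain ⟨r, hr⟩ : ∃ r, Module.finrank ℂ T = r := ⟨_, rfl⟩
  obtain ⟨M, rfl, -⟩ := exists_eq_ofSlices T hr
  rw [map_embedB_ofSlices, isEB_ofSlices, isEB_ofSlices, slicesState_pad hk]

/-- The matrix whose rows are the entries of the matrices `M j`. -/
def sliceMatrix {m n r : ℕ} (M : Fin n → Matrix (Fin m) (Fin r) ℂ) :
    Matrix (Fin n) (Fin m × Fin r) ℂ :=
  Matrix.of fun j x => M j x.1 x.2

theorem rankB_ofSlices {m n r : ℕ} (M : Fin n → Matrix (Fin m) (Fin r) ℂ) :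
    rankB (ofSlices M) = (sliceMatrix M).rank := by
  rw [rankB, supportB, Matrix.rank_eq_finrank_span_cols]
  suffices h : Submodule.span ℂ {w | ∃ v ∈ ofSlices M, ∃ i, w = fun j => v (i, j)}
      = Submodule.span ℂ (Set.range (sliceMatrix M).col) by rw [h]
  refine le_antisymm ?_ ?_ <;> rw [Submodule.span_le]
  · rintro _ ⟨v, hv, i, rfl⟩
    obtain ⟨w, rfl⟩ := (Submodule.mem_span_range_iff_exists_fun ℂ).1 hv
    have : (fun j => (∑ c, w c • fun x : Fin m × Fin n => M x.2 x.1 c) (i, j))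
        = ∑ c, w c • (sliceMatrix M).col (i, c) := by
      ext j
      simp [Finset.sum_apply, sliceMatrix]
    rw [SetLike.mem_coe, this]
    exact Submodule.sum_mem _ fun c _ => Submodule.smul_mem _ _ (Submodule.subset_span ⟨_, rfl⟩)
  · rintro _ ⟨⟨a, c⟩, rfl⟩
    exact Submodule.subset_span ⟨_, Submodule.subset_span ⟨c, rfl⟩, a, rfl⟩

theorem sliceMatrix_mix {m n n' r : ℕ} (U : Matrix (Fin n') (Fin n) ℂ)
    (M : Fin n → Matrix (Fin m) (Fin r) ℂ) :
    sliceMatrix (mix U M) = U * sliceMatrix M := by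
  ext j x
  simp [sliceMatrix, mix_apply, Matrix.mul_apply]

/-! ### Takagi factorization via antilinear eigenvectors -/

-- The square of `T` is linear, and the symmetry shows that its eigenvalue is `λ²` with `λ = ‖T x‖ /
-- ‖x‖`. Then `T x + λ x` is fixed by `T` up to the factor `λ`.
open scoped ComplexConjugate InnerProductSpace in
theorem exists_norm_one_antilinear_eigenvector {E : Type*} [NormedAddCommGroup E]
    [InnerProductSpace ℂ E] [FiniteDimensional ℂ E] [Nontrivial E] (T : E →ₗ⋆[ℂ] E)
    (hT : ∀ x y, ⟪x, T y⟫_ℂ = ⟪y, T x⟫_ℂ) :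
    ∃ x : E, ‖x‖ = 1 ∧ ∃ lam : ℝ, 0 ≤ lam ∧ T x = (lam : ℂ) • x := by
  suffices h : ∃ x : E, x ≠ 0 ∧ ∃ lam : ℝ, 0 ≤ lam ∧ T x = (lam : ℂ) • x by
    obtain ⟨x, hx, lam, hlam, h⟩ := h
    refine ⟨((‖x‖⁻¹ : ℝ) : ℂ) • x, ?_, lam, hlam, ?_⟩
    · rw [norm_smul, Complex.norm_real, norm_inv, norm_norm, inv_mul_cancel₀ (norm_ne_zero_iff.2 hx)]
    · rw [map_smulₛₗ, h, Complex.conj_ofReal, smul_comm]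
  let S : Module.End ℂ E := T.comp T
  obtain ⟨κ, hκ⟩ := Module.End.exists_eigenvalue S
  obtain ⟨x, hx⟩ := hκ.exists_hasEigenvector
  have hx0 : x ≠ 0 := hx.2
  have hSx : T (T x) = κ • x := hx.apply_eq_smul
  have hκ' : κ = ((‖T x‖ ^ 2 / ‖x‖ ^ 2 : ℝ) : ℂ) := by
    have h1 : ⟪x, T (T x)⟫_ℂ = ⟪T x, T x⟫_ℂ := hT x (T x)
    rw [hSx, inner_smul_right, inner_self_eq_norm_sq_to_K, inner_self_eq_norm_sq_to_K] at h1
    have h2 : ((‖x‖ : ℝ) : ℂ) ^ 2 ≠ 0 := by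
      simpa using hx0
    push_cast
    rw [eq_div_iff h2]
    exact h1
  set lam : ℝ := ‖T x‖ / ‖x‖ with hlam
  have hlam0 : 0 ≤ lam := by positivity
  have hκlam : κ = (lam : ℂ) * lam := by
    rw [hκ', hlam]
    push_cast
    ring
  -- If the candidate vanishes, `T x = -λ x`, and multiplying `x` by `i` flips the sign because `T`
  -- is antilinear.
  by_cases hy : T x + (lam : ℂ) • x = 0
  · have hTx : T x = -((lam : ℂ) • x) := eq_neg_of_add_eq_zero_left hy
    refine ⟨Complex.I • x, smul_ne_zero Complex.I_ne_zero hx0, lam, hlam0, ?_⟩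
    rw [map_smulₛₗ, hTx, Complex.conj_I, smul_neg, neg_smul, neg_neg, smul_comm]
  · refine ⟨_, hy, lam, hlam0, ?_⟩
    rw [map_add, map_smulₛₗ, hSx, Complex.conj_ofReal, hκlam, smul_add, smul_smul, add_comm]

open scoped ComplexConjugate InnerProductSpace in
theorem exists_orthonormal_antilinear_eigenvectors (n : ℕ) : ∀ {E : Type} [NormedAddCommGroup E]
    [InnerProductSpace ℂ E] [FiniteDimensional ℂ E] (T : E →ₗ⋆[ℂ] E)
    (_ : ∀ x y, ⟪x, T y⟫_ℂ = ⟪y, T x⟫_ℂ) (_ : Module.finrank ℂ E = n),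
    ∃ v : Fin n → E, Orthonormal ℂ v ∧ ∃ lam : Fin n → ℝ,
      ∀ i, 0 ≤ lam i ∧ T (v i) = (lam i : ℂ) • v i := by
  induction n with
  | zero =>
    intro E _ _ _ T hT _
    exact ⟨Fin.elim0, ⟨fun i => i.elim0, fun i => i.elim0⟩, Fin.elim0, fun i => i.elim0⟩
  | succ n ih =>
    intro E _ _ _ T hT hn
    have : Nontrivial E := Module.nontrivial_of_finrank_pos (R := ℂ) (by omega)
    obtain ⟨x, hx, l, hl, hTx⟩ := exists_norm_one_antilinear_eigenvector T hT
    have hx0 : x ≠ 0 := by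
      rintro rfl
      simp at hx
    let F : Submodule ℂ E := (ℂ ∙ x)ᗮ
    -- By symmetry the orthogonal complement of an eigenvector is invariant, so the induction can
    -- continue there.
    have hF : ∀ y ∈ F, T y ∈ F := by
      intro y hy
      rw [Submodule.mem_orthogonal_singleton_iff_inner_right] at hy ⊢
      rw [hT, hTx, inner_smul_right, ← inner_conj_symm, hy, map_zero, mul_zero]
    let T' : F →ₗ⋆[ℂ] F := (T.comp F.subtype).codRestrict F fun y => hF y y.2
    have hT' : ∀ y : F, ((T' y : F) : E) = T y := fun _ => rfl
    have : Fact (Module.finrank ℂ E = n + 1) := ⟨hn⟩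
    obtain ⟨v, hv, lam, hlam⟩ := ih T' (fun y z => by
      rw [Submodule.coe_inner, Submodule.coe_inner, hT', hT', hT])
      (Submodule.finrank_orthogonal_span_singleton hx0)
    refine ⟨Fin.cons x fun i => v i, ?_, Fin.cons l lam, fun i => ?_⟩
    · rw [orthonormal_iff_ite] at hv ⊢
      have hxv : ∀ i, ⟪x, (v i : E)⟫_ℂ = 0 := fun i =>
        Submodule.mem_orthogonal_singleton_iff_inner_right.1 (v i).2
      intro i j
      refine Fin.cases ?_ (fun i => ?_) i <;> refine Fin.cases ?_ (fun j => ?_) j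
      · simp [inner_self_eq_norm_sq_to_K, hx]
      · simpa [(Fin.succ_ne_zero _).symm] using hxv j
      · have := hxv i
        rw [← inner_conj_symm, map_eq_zero] at this
        simpa [Fin.succ_ne_zero] using this
      · simpa using hv i j
    · refine Fin.cases ?_ (fun i => ?_) i
      · exact ⟨hl, hTx⟩
      · refine ⟨(hlam i).1, ?_⟩
        exact congrArg Subtype.val (hlam i).2

/-- The Autonne–Takagi factorization of a complex symmetric matrix. -/
theorem exists_takagi {n : ℕ} (A : Matrix (Fin n) (Fin n) ℂ) (hA : Aᵀ = A) :
    ∃ U ∈ Matrix.unitaryGroup (Fin n) ℂ, ∃ lam : Fin n → ℝ, (∀ i, 0 ≤ lam i) ∧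
      U * A * Uᵀ = Matrix.diagonal fun i => (lam i : ℂ) := by
  -- For `T x = conj (A x)` the symmetry required of `T` is exactly `Aᵀ = A`, and the eigenvectors
  -- are the rows of the wanted unitary.
  let T : EuclideanSpace ℂ (Fin n) →ₗ⋆[ℂ] EuclideanSpace ℂ (Fin n) :=
    { toFun := fun x => WithLp.toLp 2 (star (A *ᵥ x.ofLp))
      map_add' := fun x y => by simp [Matrix.mulVec_add]
      map_smul' := fun c x => by
        ext i
        simp [Matrix.mulVec_smul] }
  have hin : ∀ x y : EuclideanSpace ℂ (Fin n),
      inner ℂ x (T y) = star (x.ofLp ⬝ᵥ A *ᵥ y.ofLp) := by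
    intro x y
    simp [T, EuclideanSpace.inner_eq_star_dotProduct, dotProduct, mul_comm]
  have hT : ∀ x y, inner ℂ x (T y) = inner ℂ y (T x) := by
    intro x y
    rw [hin, hin, Matrix.dotProduct_mulVec, ← Matrix.mulVec_transpose, hA, dotProduct_comm]
  obtain ⟨v, hv, lam, hlam⟩ := exists_orthonormal_antilinear_eigenvectors n T hT (by simp)
  refine ⟨Matrix.of fun i j => v i j, ?_, lam, fun i => (hlam i).1, ?_⟩
  · rw [Matrix.mem_unitaryGroup_iff]
    rw [orthonormal_iff_ite] at hv
    ext i j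
    have := hv j i
    simp only [EuclideanSpace.inner_eq_star_dotProduct, dotProduct] at this
    simp only [Matrix.mul_apply, Matrix.star_apply, Matrix.of_apply, Matrix.one_apply]
    simpa [eq_comm] using this
  · ext i j
    have h1 : ((Matrix.of fun i j => v i j) * A * (Matrix.of fun i j => v i j)ᵀ :
        Matrix (Fin n) (Fin n) ℂ) i j = star (inner ℂ (v i) (T (v j))) := by
      rw [hin, star_star, Matrix.mul_assoc]
      simp [Matrix.mul_apply, dotProduct, Matrix.mulVec]
    rw [h1, (hlam j).2, inner_smul_right, orthonormal_iff_ite.1 hv]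
    by_cases h : i = j
    · subst h; simp
    · simp [h]

/-! ### Closing polygons in the complex plane -/

/-- The length of `a + b * exp (i t)` runs continuously from `a + b` at `t = 0` to `|a - b|` at `t =
π`. A common rotation then makes the sum real. -/
theorem exists_norm_one_triangle {a b r : ℝ} (hr : 0 ≤ r) (h1 : |a - b| ≤ r) (h2 : r ≤ a + b) :
    ∃ u v : ℂ, ‖u‖ = 1 ∧ ‖v‖ = 1 ∧ a * u + b * v = r := by
  have hab : 0 ≤ a + b := hr.trans h2
  have hc : ContinuousOn (fun t : ℝ => ‖(a : ℂ) + b * Complex.exp (t * Complex.I)‖)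
      (Set.Icc 0 Real.pi) := by fun_prop
  have hmem : r ∈ Set.Icc ‖(a : ℂ) + b * Complex.exp ((Real.pi : ℝ) * Complex.I)‖
      ‖(a : ℂ) + b * Complex.exp ((0 : ℝ) * Complex.I)‖ := by
    constructor
    · rw [Complex.exp_pi_mul_I, mul_neg_one, ← sub_eq_add_neg, ← Complex.ofReal_sub,
        Complex.norm_real]
      exact h1
    · rw [Complex.ofReal_zero, zero_mul, Complex.exp_zero, mul_one, ← Complex.ofReal_add,
        Complex.norm_real]
      exact h2.trans (le_abs_self _)
  obtain ⟨t, -, ht⟩ := intermediate_value_Icc' Real.pi_pos.le hc hmem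
  set z : ℂ := (a : ℂ) + b * Complex.exp (t * Complex.I) with hz
  have hz' : (r : ℂ) * Complex.exp (Complex.arg z * Complex.I) = z := by
    rw [← ht]
    exact Complex.norm_mul_exp_arg_mul_I z
  refine ⟨Complex.exp ((-Complex.arg z : ℝ) * Complex.I),
    Complex.exp ((t - Complex.arg z : ℝ) * Complex.I), Complex.norm_exp_ofReal_mul_I _,
    Complex.norm_exp_ofReal_mul_I _, ?_⟩
  have e1 : Complex.exp ((t - Complex.arg z : ℝ) * Complex.I)
      = Complex.exp (t * Complex.I) * Complex.exp ((-Complex.arg z : ℝ) * Complex.I) := by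
    rw [← Complex.exp_add]
    congr 1
    push_cast
    ring
  calc _ = z * Complex.exp ((-Complex.arg z : ℝ) * Complex.I) := by
        rw [e1, hz]; ring
    _ = r := by
        nth_rewrite 1 [← hz']
        rw [mul_assoc, ← Complex.exp_add, ← add_mul, ← Complex.ofReal_add, add_neg_cancel]
        simp

/-- Four lengths satisfying the polygon inequalities close up to a quadrilateral. -/
theorem exists_norm_one_quadrilateral {l : Fin 4 → ℝ} (h0 : ∀ i, 0 ≤ l i)
    (h : ∀ i, 2 * l i ≤ ∑ j, l j) : ∃ u : Fin 4 → ℂ, (∀ i, ‖u i‖ = 1) ∧ ∑ i, l i * u i = 0 := by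
  simp only [Fin.sum_univ_four] at h ⊢
  have a0 := h 0
  have a1 := h 1
  have a2 := h 2
  have a3 := h 3
  have b0 := h0 0
  have b1 := h0 1
  have b2 := h0 2
  have b3 := h0 3
  -- The diagonal of the quadrilateral: the polygon inequalities say that this length closes a
  -- triangle with either pair of sides.
  set r := max |l 0 - l 1| |l 2 - l 3| with hr
  have hr0 : 0 ≤ r := (abs_nonneg _).trans (le_max_left _ _)
  have c1 : r ≤ l 0 + l 1 := by
    refine max_le (abs_le.2 ⟨?_, ?_⟩) (abs_le.2 ⟨?_, ?_⟩) <;> linarith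
  have c2 : r ≤ l 2 + l 3 := by
    refine max_le (abs_le.2 ⟨?_, ?_⟩) (abs_le.2 ⟨?_, ?_⟩) <;> linarith
  obtain ⟨u, v, hu, hv, e1⟩ := exists_norm_one_triangle hr0 (le_max_left _ _) c1
  obtain ⟨w, x, hw, hx, e2⟩ := exists_norm_one_triangle hr0 (le_max_right _ _) c2
  refine ⟨![u, v, -w, -x], fun i => ?_, ?_⟩
  · fin_cases i <;> simpa
  · simp only [Matrix.cons_val]
    linear_combination e1 - e2

/-! ### Polarized determinant and product decompositions -/

/-- The polarization of `X ↦ 2 * det X`. -/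
def polarDet : Matrix (Fin 2) (Fin 2) ℂ →ₗ[ℂ] Matrix (Fin 2) (Fin 2) ℂ →ₗ[ℂ] ℂ :=
  LinearMap.mk₂ ℂ (fun X Y => X 0 0 * Y 1 1 + X 1 1 * Y 0 0 - X 0 1 * Y 1 0 - X 1 0 * Y 0 1)
    (fun X X' Y => by simp only [Matrix.add_apply]; ring)
    (fun c X Y => by simp only [Matrix.smul_apply, smul_eq_mul]; ring)
    (fun X Y Y' => by simp only [Matrix.add_apply]; ring)
    (fun c X Y => by simp only [Matrix.smul_apply, smul_eq_mul]; ring)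

theorem polarDet_apply (X Y : Matrix (Fin 2) (Fin 2) ℂ) :
    polarDet X Y = X 0 0 * Y 1 1 + X 1 1 * Y 0 0 - X 0 1 * Y 1 0 - X 1 0 * Y 0 1 := rfl

theorem polarDet_vecMulVec_self (μ ν : Fin 2 → ℂ) :
    polarDet (Matrix.vecMulVec μ ν) (Matrix.vecMulVec μ ν) = 0 := by
  simp only [polarDet_apply, Matrix.vecMulVec_apply]
  ring

theorem exists_eq_vecMulVec {X : Matrix (Fin 2) (Fin 2) ℂ} (hX : polarDet X X = 0) :
    ∃ μ ν : Fin 2 → ℂ, ν ≠ 0 ∧ X = Matrix.vecMulVec μ ν := by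
  rw [polarDet_apply] at hX
  have hd : X 0 0 * X 1 1 = X 0 1 * X 1 0 := by linear_combination hX / 2
  by_cases h : X 0 = 0
  · by_cases h' : X 1 = 0
    · refine ⟨0, ![1, 0], fun h => one_ne_zero (congrFun h 0), ?_⟩
      ext i j
      fin_cases i
      · simpa using congrFun h j
      · simpa using congrFun h' j
    · refine ⟨![0, 1], X 1, h', ?_⟩
      ext i j
      fin_cases i
      · simpa [Matrix.vecMulVec_apply] using congrFun h j
      · simp [Matrix.vecMulVec_apply]
  · by_cases h0 : X 0 0 = 0
    · have h1 : X 0 1 ≠ 0 := fun h1 => h (by ext j; fin_cases j <;> assumption)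
      refine ⟨![1, X 1 1 / X 0 1], X 0, h, ?_⟩
      have : X 1 0 = 0 := by
        rw [h0, zero_mul] at hd
        exact (mul_eq_zero.1 hd.symm).resolve_left h1
      ext i j
      fin_cases i <;> fin_cases j <;> simp [Matrix.vecMulVec_apply, h0, this, h1]
    · refine ⟨![1, X 1 0 / X 0 0], X 0, h, ?_⟩
      ext i j
      fin_cases i <;> fin_cases j <;> simp [Matrix.vecMulVec_apply, h0]
      field_simp
      linear_combination hd

/-- The Gram matrix of a family with respect to `polarDet`. -/
def gram {n : ℕ} (M : Fin n → Matrix (Fin 2) (Fin 2) ℂ) : Matrix (Fin n) (Fin n) ℂ :=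
  Matrix.of fun i j => polarDet (M i) (M j)

theorem gram_transpose {n : ℕ} (M : Fin n → Matrix (Fin 2) (Fin 2) ℂ) : (gram M)ᵀ = gram M := by
  ext i j
  simp only [gram, Matrix.transpose_apply, Matrix.of_apply, polarDet_apply]
  ring

theorem gram_mix {n n' : ℕ} (U : Matrix (Fin n') (Fin n) ℂ)
    (M : Fin n → Matrix (Fin 2) (Fin 2) ℂ) : gram (mix U M) = U * gram M * Uᵀ := by
  ext i j
  rw [Matrix.mul_assoc]
  simp only [gram, Matrix.of_apply, mix, map_sum, LinearMap.sum_apply, map_smul,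
    LinearMap.smul_apply, smul_eq_mul, Matrix.mul_apply, Matrix.transpose_apply, Finset.mul_sum]
  refine (Finset.sum_comm).trans (Finset.sum_congr rfl fun k _ => Finset.sum_congr rfl fun l _ => ?_)
  ring

/-- Both sums are the value of one sesquilinear expression in the state, hence do not depend on the
chosen decomposition. -/
theorem sum_functional_eq {α β : Type*} [Fintype α] [Fintype β] [DecidableEq α] [DecidableEq β]
    {n N : ℕ} {M : Fin n → Matrix α β ℂ} {P : Fin N → Matrix α β ℂ}
    (h : slicesState M = slicesState P) (φ : Matrix α β ℂ →ₗ[ℂ] ℂ) :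
    ∑ j, φ (M j) * star (φ (M j)) = ∑ s, φ (P s) * star (φ (P s)) := by
  have e : ∀ {k : ℕ} (f : Fin k → Matrix α β ℂ), ∑ j, φ (f j) * star (φ (f j))
      = ∑ x : α × β, ∑ y : α × β, slicesState f x y *
        (φ (Matrix.single x.1 x.2 1) * star (φ (Matrix.single y.1 y.2 1))) := by
    intro k f
    have e1 : ∀ X : Matrix α β ℂ, φ X = ∑ x : α × β, X x.1 x.2 * φ (Matrix.single x.1 x.2 1) := by
      intro X
      conv_lhs => rw [Matrix.matrix_eq_sum_single X]
      simp only [map_sum, Fintype.sum_prod_type]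
      refine Finset.sum_congr rfl fun a _ => Finset.sum_congr rfl fun b _ => ?_
      rw [← smul_eq_mul, ← map_smul, Matrix.smul_single, smul_eq_mul, mul_one]
    simp only [fun j => e1 (f j), star_sum, star_mul', slicesState_apply]
    simp only [Finset.sum_mul_sum]
    simp only [Finset.sum_mul]
    rw [Finset.sum_comm]
    refine Finset.sum_congr rfl fun x _ => ?_
    rw [Finset.sum_comm]
    refine Finset.sum_congr rfl fun y _ => Finset.sum_congr rfl fun j _ => ?_
    ring
  rw [e, e, h]

/-- A functional that vanishes on all `M j` has `∑ |φ (P s)|² = 0`, hence vanishes on every `P s`.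
-/
theorem mem_span_of_slicesState_eq {α β : Type*} [Fintype α] [Fintype β] [DecidableEq α]
    [DecidableEq β] {n N : ℕ} {M : Fin n → Matrix α β ℂ} {P : Fin N → Matrix α β ℂ}
    (h : slicesState M = slicesState P) (s : Fin N) : P s ∈ Submodule.span ℂ (Set.range M) := by
  by_contra hs
  obtain ⟨φ, hφ, hker⟩ := Submodule.exists_le_ker_of_notMem hs
  have h0 : ∑ s, φ (P s) * star (φ (P s)) = 0 := by
    rw [← sum_functional_eq h φ]
    refine Finset.sum_eq_zero fun j _ => ?_
    rw [LinearMap.mem_ker.1 (hker (Submodule.subset_span ⟨j, rfl⟩)), zero_mul]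
  have h1 : ∑ s, ‖φ (P s)‖ ^ 2 = 0 := by
    have : ((∑ s, ‖φ (P s)‖ ^ 2 : ℝ) : ℂ) = 0 := by
      rw [← h0]
      push_cast
      exact Finset.sum_congr rfl fun s _ => (RCLike.mul_conj (φ (P s))).symm
    exact_mod_cast this
  have h2 := (Finset.sum_eq_zero_iff_of_nonneg fun s _ => by positivity).1 h1 s (Finset.mem_univ s)
  exact hφ (by simpa using h2)

/-- If the Gram matrix is diagonal and the state separable, the diagonal satisfies the polygon
inequalities. -/
theorem two_mul_le_sum_of_isSeparable {n : ℕ} {M : Fin n → Matrix (Fin 2) (Fin 2) ℂ}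
    {l : Fin n → ℝ} (h0 : ∀ i, 0 ≤ l i) (hg : gram M = Matrix.diagonal fun i => (l i : ℂ))
    (hsep : IsSeparable (slicesState M)) (i : Fin n) : 2 * l i ≤ ∑ j, l j := by
  obtain ⟨N, μ, ν, hN⟩ := isSeparable_iff.1 hsep
  have hM : ∀ i j, polarDet (M i) (M j) = if i = j then (l i : ℂ) else 0 := fun i j => by
    have := congrFun (congrFun hg i) j
    rwa [Matrix.diagonal_apply] at this
  have hc : ∀ s, ∃ c : Fin n → ℂ, ∑ j, c j • M j = Matrix.vecMulVec (μ s) (ν s) := fun s =>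
    (Submodule.mem_span_range_iff_exists_fun ℂ).1 (mem_span_of_slicesState_eq hN s)
  choose c hc using hc
  have h1 : ∀ i s, polarDet (M i) (Matrix.vecMulVec (μ s) (ν s)) = l i * c s i := fun i s => by
    rw [← hc, map_sum]
    simp [hM, mul_comm]
  have h2 : ∀ s, ∑ j, (l j : ℂ) * c s j ^ 2 = 0 := fun s => by
    rw [← polarDet_vecMulVec_self (μ s) (ν s)]
    conv_rhs => rw [← hc s]
    simp only [map_sum, LinearMap.sum_apply, map_smul, LinearMap.smul_apply, hM, smul_eq_mul]
    simp only [mul_ite, mul_zero, Finset.sum_ite_eq', Finset.mem_univ, if_true]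
    exact Finset.sum_congr rfl fun j _ => by ring
  -- Testing both decompositions with `polarDet (M i)` gives `∑ s, ‖c s i‖² = 1` whenever `l i ≠ 0`.
  have h3 : ∀ i, l i * ∑ s, ‖c s i‖ ^ 2 = l i := fun i => by
    have h := sum_functional_eq hN (polarDet (M i))
    simp only [h1, hM] at h
    have h' : (l i : ℂ) * l i = ∑ s, l i * c s i * star (l i * c s i) := by
      rw [← h, Finset.sum_eq_single i]
      · simp
      · intro j _ hj
        simp [hj.symm]
      · simp
    have h'' : l i * l i = l i * (l i * ∑ s, ‖c s i‖ ^ 2) := by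
      have : ((l i * l i : ℝ) : ℂ) = ((l i * (l i * ∑ s, ‖c s i‖ ^ 2) : ℝ) : ℂ) := by
        push_cast
        rw [h', Finset.mul_sum, Finset.mul_sum]
        refine Finset.sum_congr rfl fun s _ => ?_
        rw [← Complex.mul_conj']
        simp only [star_mul', RCLike.star_def, Complex.conj_ofReal]
        ring
      exact_mod_cast this
    by_cases hl : l i = 0
    · rw [hl, zero_mul]
    · exact (mul_left_cancel₀ hl h'').symm
  -- By `h2` one term is minus the sum of the others; the triangle inequality bounds it, and summing
  -- over `s` with `h3` gives the claim.
  have h4 : ∀ s, 2 * (l i * ‖c s i‖ ^ 2) ≤ ∑ j, l j * ‖c s j‖ ^ 2 := fun s => by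
    have hn : ∀ j, ‖(l j : ℂ) * c s j ^ 2‖ = l j * ‖c s j‖ ^ 2 := fun j => by
      rw [norm_mul, norm_pow, Complex.norm_real, Real.norm_of_nonneg (h0 j)]
    have e1 := Finset.add_sum_erase Finset.univ (fun j => (l j : ℂ) * c s j ^ 2) (Finset.mem_univ i)
    have e2 := Finset.add_sum_erase Finset.univ (fun j => l j * ‖c s j‖ ^ 2) (Finset.mem_univ i)
    rw [h2] at e1
    have e3 := norm_sum_le (Finset.univ.erase i) fun j => (l j : ℂ) * c s j ^ 2
    rw [← norm_neg, ← eq_neg_of_add_eq_zero_left e1, hn] at e3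
    simp only [hn] at e3
    linarith
  calc 2 * l i = ∑ s, 2 * (l i * ‖c s i‖ ^ 2) := by
        rw [← Finset.mul_sum, ← Finset.mul_sum, h3]
    _ ≤ ∑ s, ∑ j, l j * ‖c s j‖ ^ 2 := Finset.sum_le_sum fun s _ => h4 s
    _ = ∑ j, l j := by
        rw [Finset.sum_comm]
        refine Finset.sum_congr rfl fun j _ => ?_
        rw [← Finset.mul_sum, h3]

theorem submatrix_mem_unitaryGroup {n : ℕ} {U : Matrix (Fin n) (Fin n) ℂ}
    (hU : U ∈ Matrix.unitaryGroup (Fin n) ℂ) (σ τ : Equiv.Perm (Fin n)) :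
    U.submatrix σ τ ∈ Matrix.unitaryGroup (Fin n) ℂ := by
  rw [Matrix.mem_unitaryGroup_iff, Matrix.star_eq_conjTranspose] at hU ⊢
  rw [Matrix.conjTranspose_submatrix, Matrix.submatrix_mul_equiv, hU,
    Matrix.submatrix_one_equiv]

theorem mix_submatrix {n : ℕ} {α β : Type*} (U : Matrix (Fin n) (Fin n) ℂ)
    (σ : Equiv.Perm (Fin n)) (M : Fin n → Matrix α β ℂ) :
    mix (U.submatrix σ id) M = mix U M ∘ σ := rfl

theorem diagonal_mem_unitaryGroup {n : ℕ} {e : Fin n → ℂ} (he : ∀ i, ‖e i‖ = 1) :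
    Matrix.diagonal e ∈ Matrix.unitaryGroup (Fin n) ℂ := by
  rw [Matrix.mem_unitaryGroup_iff, Matrix.star_eq_conjTranspose, Matrix.diagonal_conjTranspose,
    Matrix.diagonal_mul_diagonal, ← Matrix.diagonal_one]
  congr 1
  ext i
  simp [Complex.mul_conj', he]

theorem isUnit_det_of_mem_unitaryGroup {n : ℕ} {U : Matrix (Fin n) (Fin n) ℂ}
    (hU : U ∈ Matrix.unitaryGroup (Fin n) ℂ) : IsUnit U.det := by
  rw [← Matrix.isUnit_iff_isUnit_det]
  exact IsUnit.of_mul_eq_one _ (Matrix.mem_unitaryGroup_iff.1 hU)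

theorem polarDet_mix_self {n : ℕ} {M : Fin n → Matrix (Fin 2) (Fin 2) ℂ} {l : Fin n → ℂ}
    (hg : gram M = Matrix.diagonal l) (U : Matrix (Fin n) (Fin n) ℂ) (k : Fin n) :
    polarDet (mix U M k) (mix U M k) = ∑ j, U k j ^ 2 * l j := by
  have h : polarDet (mix U M k) (mix U M k) = gram (mix U M) k k := rfl
  rw [h, gram_mix, hg]
  simp only [Matrix.mul_apply, Matrix.diagonal_apply, Matrix.transpose_apply, mul_ite, mul_zero,
    Finset.sum_ite_eq', Finset.mem_univ, if_true]
  exact Finset.sum_congr rfl fun j _ => by ring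

/-- For a separable state the family can be recombined unitarily so that the Gram matrix becomes
diagonal with entries satisfying the polygon inequalities. -/
theorem exists_gram_mix_eq_diagonal {n : ℕ} {M : Fin n → Matrix (Fin 2) (Fin 2) ℂ}
    (hsep : IsSeparable (slicesState M)) :
    ∃ V ∈ Matrix.unitaryGroup (Fin n) ℂ, ∃ l : Fin n → ℝ, (∀ i, 0 ≤ l i) ∧
      (gram (mix V M) = Matrix.diagonal fun i => (l i : ℂ)) ∧ ∀ i, 2 * l i ≤ ∑ j, l j := by
  obtain ⟨V, hV, l, h0, hl⟩ := exists_takagi (gram M) (gram_transpose M)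
  rw [← gram_mix] at hl
  exact ⟨V, hV, l, h0, hl, two_mul_le_sum_of_isSeparable h0 hl (by rwa [slicesState_mix hV])⟩

theorem exists_mix_polarDet_eq_zero_of_four {M : Fin 4 → Matrix (Fin 2) (Fin 2) ℂ}
    (hsep : IsSeparable (slicesState M)) :
    ∃ U ∈ Matrix.unitaryGroup (Fin 4) ℂ, ∀ k, polarDet (mix U M k) (mix U M k) = 0 := by
  obtain ⟨V, hV, l, h0, hl, hp⟩ := exists_gram_mix_eq_diagonal hsep
  obtain ⟨u, hu, hsum⟩ := exists_norm_one_quadrilateral h0 hp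
  -- Square roots, since the Gram matrix is quadratic in the recombination.
  have he : ∀ i, ∃ e : ℂ, e ^ 2 = u i := fun i => IsAlgClosed.exists_pow_nat_eq _ two_pos
  choose e he using he
  have he1 : ∀ i, ‖e i‖ = 1 := fun i => by
    have : ‖e i‖ ^ 2 = 1 := by rw [← norm_pow, he, hu]
    exact (pow_eq_one_iff_of_nonneg (norm_nonneg _) two_ne_zero).1 this
  -- A normalized Hadamard matrix: all squared entries are 1/4, so every new slice has polar
  -- determinant `(1/4) ∑ l j * u j = 0`.
  let H : Matrix (Fin 4) (Fin 4) ℂ := (1 / 2 : ℂ) •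
    !![1, 1, 1, 1; 1, 1, -1, -1; 1, -1, 1, -1; 1, -1, -1, 1]
  have hH : H ∈ Matrix.unitaryGroup (Fin 4) ℂ := by
    rw [Matrix.mem_unitaryGroup_iff]
    have h2 : (starRingEnd ℂ) 2 = 2 := map_ofNat _ 2
    ext i j
    fin_cases i <;> fin_cases j <;>
      simp [H, Matrix.mul_apply, Fin.sum_univ_four, Matrix.star_apply, h2] <;> norm_num
  have hH2 : ∀ k j, H k j ^ 2 = 1 / 4 := by
    intro k j
    fin_cases k <;> fin_cases j <;> simp [H] <;> norm_num
  refine ⟨H * Matrix.diagonal e * V,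
    mul_mem (mul_mem hH (diagonal_mem_unitaryGroup he1)) hV, fun k => ?_⟩
  rw [← mix_mix, polarDet_mix_self hl]
  simp only [Matrix.mul_diagonal, mul_pow, hH2, he]
  rw [← mul_zero (1 / 4 : ℂ), ← hsum, Finset.mul_sum]
  exact Finset.sum_congr rfl fun j _ => by ring

theorem exists_mix_polarDet_eq_zero_of_three {M : Fin 3 → Matrix (Fin 2) (Fin 2) ℂ}
    (hsep : IsSeparable (slicesState M)) (hdet : (gram M).det = 0) :
    ∃ U ∈ Matrix.unitaryGroup (Fin 3) ℂ, ∀ k, polarDet (mix U M k) (mix U M k) = 0 := by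
  obtain ⟨V, hV, l, h0, hl, hp⟩ := exists_gram_mix_eq_diagonal hsep
  obtain ⟨i, hi⟩ : ∃ i, l i = 0 := by
    have h := congrArg Matrix.det hl
    rw [gram_mix, Matrix.det_mul, Matrix.det_mul, hdet, mul_zero, zero_mul,
      Matrix.det_diagonal] at h
    obtain ⟨i, -, hi⟩ := Finset.prod_eq_zero_iff.1 h.symm
    exact ⟨i, by exact_mod_cast hi⟩
  let σ : Equiv.Perm (Fin 3) := Equiv.swap i 2
  have h2 : l (σ 2) = 0 := by simp [σ, hi]
  have hsum : ∑ j, l j = l (σ 0) + l (σ 1) + l (σ 2) := by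
    rw [← Equiv.sum_comp σ, Fin.sum_univ_three]
  -- With one side zero the polygon is a segment run through twice.
  have h01 : l (σ 0) = l (σ 1) := by
    have a := hp (σ 0)
    have b := hp (σ 1)
    rw [hsum] at a b
    linarith
  obtain ⟨s, hs⟩ : ∃ s : ℝ, s ^ 2 = 1 / 2 := ⟨√(1 / 2), Real.sq_sqrt (by norm_num)⟩
  have hs' : (s : ℂ) ^ 2 = 1 / 2 := by
    rw [← Complex.ofReal_pow, hs]
    norm_num
  -- The squared entries of the first two rows are `1/2, -1/2, 0`, which cancel equal lengths; the
  -- third row only sees the zero length.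
  let H : Matrix (Fin 3) (Fin 3) ℂ :=
    !![(s : ℂ), Complex.I * s, 0; (s : ℂ), -(Complex.I * s), 0; 0, 0, 1]
  have hH : H ∈ Matrix.unitaryGroup (Fin 3) ℂ := by
    rw [Matrix.mem_unitaryGroup_iff]
    ext i j
    fin_cases i <;> fin_cases j <;>
      simp [H, Matrix.mul_apply, Fin.sum_univ_three, Matrix.star_apply] <;>
      first
      | linear_combination (1 - Complex.I ^ 2) * hs' - (1 / 2) * Complex.I_sq
      | linear_combination (s : ℂ) ^ 2 * Complex.I_sq
  refine ⟨H.submatrix (Equiv.refl _) σ.symm * V,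
    mul_mem (submatrix_mem_unitaryGroup hH _ _) hV, fun k => ?_⟩
  rw [← mix_mix, polarDet_mix_self hl, ← Equiv.sum_comp σ, Fin.sum_univ_three, h2, h01]
  simp only [Matrix.submatrix_apply, Equiv.refl_apply, Equiv.symm_apply_apply]
  fin_cases k <;> simp [H, mul_pow]

theorem polarDet_eq_zero_of_one {M : Fin 1 → Matrix (Fin 2) (Fin 2) ℂ}
    (hsep : IsSeparable (slicesState M)) : polarDet (M 0) (M 0) = 0 := by
  obtain ⟨V, hV, l, h0, hl, hp⟩ := exists_gram_mix_eq_diagonal hsep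
  have hl0 : l 0 = 0 := by
    have := hp 0
    rw [Fin.sum_univ_one] at this
    linarith [h0 0]
  have hV0 : V 0 0 ≠ 0 := by
    have := (isUnit_det_of_mem_unitaryGroup hV).ne_zero
    rwa [Matrix.det_fin_one] at this
  have h := congrFun (congrFun hl 0) 0
  simp only [gram, Matrix.of_apply, mix, Fin.sum_univ_one, map_smul, LinearMap.smul_apply,
    smul_eq_mul, Matrix.diagonal_apply_eq, hl0, Complex.ofReal_zero, mul_eq_zero] at h
  tauto

/-! ### Compression to the support on B -/

theorem mem_unitaryGroup_of_orthonormal {n : ℕ} {v : Fin n → EuclideanSpace ℂ (Fin n)}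
    (hv : Orthonormal ℂ v) :
    (Matrix.of fun i j => star (v i j)) ∈ Matrix.unitaryGroup (Fin n) ℂ := by
  rw [Matrix.mem_unitaryGroup_iff]
  rw [orthonormal_iff_ite] at hv
  ext i j
  have := hv i j
  simp only [EuclideanSpace.inner_eq_star_dotProduct, dotProduct] at this
  simp only [Matrix.mul_apply, Matrix.star_apply, Matrix.of_apply, Matrix.one_apply]
  simpa [mul_comm] using this

/-- A unitary moves the column space of a matrix of rank `r` to the first `r` coordinates. -/
theorem exists_unitary_mul_eq_zero {n : ℕ} {κ : Type*} [Fintype κ] (A : Matrix (Fin n) κ ℂ) :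
    ∃ U ∈ Matrix.unitaryGroup (Fin n) ℂ, ∀ j : Fin n, A.rank ≤ j → ∀ x, (U * A) j x = 0 := by
  let e := (WithLp.linearEquiv 2 ℂ (Fin n → ℂ)).symm
  let S : Submodule ℂ (EuclideanSpace ℂ (Fin n)) :=
    (Submodule.span ℂ (Set.range A.col)).map e.toLinearMap
  have hS : Module.finrank ℂ S = A.rank := by
    rw [Matrix.rank_eq_finrank_span_cols]
    exact LinearEquiv.finrank_map_eq e _
  let q := (stdOrthonormalBasis ℂ S).reindex (finCongr hS)
  let v : Fin n → EuclideanSpace ℂ (Fin n) := fun j =>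
    if h : (j : ℕ) < A.rank then (q ⟨j, h⟩ : EuclideanSpace ℂ (Fin n)) else 0
  have hv : Orthonormal ℂ (Set.domRestrict {j : Fin n | (j : ℕ) < A.rank} v) := by
    have hq := orthonormal_iff_ite.1 q.orthonormal
    rw [orthonormal_iff_ite]
    rintro ⟨i, hi⟩ ⟨j, hj⟩
    have := hq ⟨i, hi⟩ ⟨j, hj⟩
    rw [Submodule.coe_inner] at this
    rw [Set.mem_ofPred_eq] at hi hj
    simpa [v, Set.domRestrict, hi, hj, Fin.ext_iff] using this
  obtain ⟨b, hb⟩ := hv.exists_orthonormalBasis_extension_of_card_eq (by simp)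
  refine ⟨_, mem_unitaryGroup_of_orthonormal b.orthonormal, fun j hj x => ?_⟩
  have hA : e (A.col x) ∈ S := Submodule.mem_map_of_mem (Submodule.subset_span ⟨x, rfl⟩)
  have hrep := congrArg (Subtype.val) (q.sum_repr ⟨e (A.col x), hA⟩)
  have hin : inner ℂ (b j) (e (A.col x)) = 0 := by
    rw [Submodule.coe_sum] at hrep
    change _ = e (A.col x) at hrep
    rw [← hrep, inner_sum]
    refine Finset.sum_eq_zero fun i _ => ?_
    have hin' : (i : ℕ) < n := i.2.trans_le (by simpa using A.rank_le_card_height)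
    have h1 : b ⟨i, hin'⟩ = q i := by
      rw [hb ⟨i, hin'⟩ i.2]
      simp [v]
    rw [Submodule.coe_smul, inner_smul_right, ← h1, orthonormal_iff_ite.1 b.orthonormal,
      if_neg, mul_zero]
    intro h
    have := i.2
    rw [h] at hj
    simp at hj
    omega
  simp only [EuclideanSpace.inner_eq_star_dotProduct, dotProduct] at hin
  rw [Matrix.mul_apply, ← hin]
  refine Finset.sum_congr rfl fun k _ => ?_
  simp [e, mul_comm]

theorem finrank_map_of_injective {E F : Type*} [AddCommGroup E] [Module ℂ E] [AddCommGroup F]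
    [Module ℂ F] {f : E →ₗ[ℂ] F} (hf : Function.Injective f) (V : Submodule ℂ E) :
    Module.finrank ℂ (V.map f) = Module.finrank ℂ V :=
  (Submodule.equivMapOfInjective f hf V).finrank_eq.symm

theorem image_inv_image {m n : ℕ} {W : Matrix (Fin m) (Fin m) ℂ}
    {U : Matrix (Fin n) (Fin n) ℂ} (hW : IsUnit W.det) (hU : IsUnit U.det)
    (V : Submodule ℂ (Bip m n)) : image W⁻¹ U⁻¹ (image W U V) = V := by
  rw [image_image, Matrix.nonsing_inv_mul _ hW, Matrix.nonsing_inv_mul _ hU, image_one]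

theorem finrank_image {m n : ℕ} {W : Matrix (Fin m) (Fin m) ℂ}
    {U : Matrix (Fin n) (Fin n) ℂ} (hW : IsUnit W.det) (hU : IsUnit U.det)
    (V : Submodule ℂ (Bip m n)) : Module.finrank ℂ (image W U V) = Module.finrank ℂ V := by
  refine le_antisymm (Submodule.finrank_map_le _ _) ?_
  conv_lhs => rw [← image_inv_image hW hU V]
  exact Submodule.finrank_map_le _ _

/-- A single slice would have to be a product, so its two columns are dependent and span at most a
line. -/
theorem ne_one_of_isEB {T : Submodule ℂ (Bip 2 1)} (hT : Module.finrank ℂ T = 2) : ¬ IsEB T := by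
  intro h
  obtain ⟨M, rfl, hli⟩ := exists_eq_ofSlices T hT
  obtain ⟨μ, ν, hν, hM⟩ := exists_eq_vecMulVec (polarDet_eq_zero_of_one (isEB_ofSlices.1 h))
  rw [Fintype.linearIndependent_iff] at hli
  have h0 := hli ![ν 1, -ν 0] (by
    ext ⟨a, j⟩
    fin_cases j
    simp [hM, Fin.sum_univ_two, Matrix.vecMulVec_apply]
    ring)
  refine hν ?_
  ext i
  fin_cases i
  · simpa using h0 1
  · simpa using h0 0

theorem exists_luEquivalent {n : ℕ} {V : Submodule ℂ (Bip 2 n)} (hV : Module.finrank ℂ V = 2)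
    (hEB : IsEB V) : ∃ k : ℕ, (k = 2 ∨ k = 3 ∨ k = 4) ∧ ∃ (hk : k ≤ n)
      (T : Submodule ℂ (Bip 2 k)), IsEB T ∧ rankB T = k ∧ LUEquivalent V (T.map (embedB hk)) := by
  obtain ⟨M, rfl, hli⟩ := exists_eq_ofSlices V hV
  obtain ⟨U, hU, hU0⟩ := exists_unitary_mul_eq_zero (sliceMatrix M)
  obtain ⟨r, hr⟩ : ∃ r, (sliceMatrix M).rank = r := ⟨_, rfl⟩
  have hrn : r ≤ n := hr ▸ (by simpa using (sliceMatrix M).rank_le_card_height)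
  -- The rows of `sliceMatrix M` have `2 * 2` entries.
  have hr4 : r ≤ 4 := hr ▸ (by simpa using (sliceMatrix M).rank_le_card_width)
  rw [hr] at hU0
  let N : Fin r → Matrix (Fin 2) (Fin 2) ℂ := fun j => mix U M (Fin.castLE hrn j)
  have hpad : (fun j : Fin n => if h : (j : ℕ) < r then N ⟨j, h⟩ else 0) = mix U M := by
    ext j a c
    by_cases h : (j : ℕ) < r
    · simp [h, N]
    · have := hU0 j (not_lt.1 h) (a, c)
      rw [← sliceMatrix_mix] at this
      simpa [h, sliceMatrix] using this.symm
  have himg : (ofSlices N).map (embedB hrn) = image 1 U (ofSlices M) := by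
    rw [map_embedB_ofSlices, hpad, image_ofSlices]
    simp
  have hEB' : IsEB (ofSlices N) := by
    rw [← isEB_map_embedB hrn, himg]
    exact hEB.image 1 hU
  have hfr : Module.finrank ℂ (ofSlices N) = 2 := by
    rw [← finrank_map_of_injective (embedB_injective hrn), himg,
      finrank_image (by simp) (isUnit_det_of_mem_unitaryGroup hU), hV]
  have hrank : rankB (ofSlices N) = r := by
    rw [rankB_ofSlices]
    refine le_antisymm (by simpa using (sliceMatrix N).rank_le_card_height) ?_
    have h1 : (sliceMatrix (mix U M)).rank = r := by
      rw [sliceMatrix_mix, Matrix.rank_mul_eq_right_of_isUnit_det _ _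
        (isUnit_det_of_mem_unitaryGroup hU), hr]
    have h2 : sliceMatrix (mix U M)
        = (1 : Matrix (Fin n) (Fin n) ℂ).submatrix id (Fin.castLE hrn) * sliceMatrix N := by
      ext j x
      rw [← hpad]
      by_cases h : (j : ℕ) < r
      · rw [Matrix.mul_apply, Finset.sum_eq_single ⟨j, h⟩]
        · simp [sliceMatrix, h, Matrix.one_apply]
        · intro i _ hi
          rw [Matrix.submatrix_apply, Matrix.one_apply_ne, zero_mul]
          rintro rfl
          exact hi (Fin.ext rfl)
        · simp
      · rw [Matrix.mul_apply, Finset.sum_eq_zero]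
        · simp [sliceMatrix, h]
        · intro i _
          rw [Matrix.submatrix_apply, Matrix.one_apply_ne, zero_mul]
          rintro rfl
          exact h i.2
    have h3 := Matrix.rank_mul_le_right
      ((1 : Matrix (Fin n) (Fin n) ℂ).submatrix id (Fin.castLE hrn)) (sliceMatrix N)
    rwa [← h2, h1] at h3
  refine ⟨r, ?_, hrn, ofSlices N, hEB', hrank, ?_, 1, U, one_mem _, hU, fun a ha => ?_⟩
  · clear himg hpad hrank hU0 hr
    have h0 : r ≠ 0 := by
      rintro rfl
      have := Submodule.finrank_le (ofSlices N)
      rw [hfr] at this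
      simp at this
    have h1 : r ≠ 1 := by
      rintro rfl
      exact ne_one_of_isEB hfr hEB'
    omega
  · rw [hV, finrank_map_of_injective (embedB_injective hrn), hfr]
  · rw [himg]
    exact Submodule.mem_map_of_mem ha

/-! ### The case of B-rank four -/

theorem ofSlices_two {m n : ℕ} (M : Fin n → Matrix (Fin m) (Fin 2) ℂ) :
    ofSlices M = Submodule.span ℂ {fun x => M x.2 x.1 0, fun x => M x.2 x.1 1} := by
  rw [ofSlices]
  congr 1
  ext v
  simp [Fin.exists_fin_two, eq_comm]

theorem rankB_image_le {m m' n n' : ℕ} (W : Matrix (Fin m') (Fin m) ℂ)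
    (U : Matrix (Fin n') (Fin n) ℂ) (V : Submodule ℂ (Bip m n)) :
    rankB (image W U V) ≤ rankB V := by
  obtain ⟨r, hr⟩ : ∃ r, Module.finrank ℂ V = r := ⟨_, rfl⟩
  obtain ⟨M, rfl, -⟩ := exists_eq_ofSlices V hr
  rw [image_ofSlices, rankB_ofSlices, rankB_ofSlices]
  have h : sliceMatrix (fun j => W * mix U M j)
      = U * (sliceMatrix M * (W ⊗ₖ (1 : Matrix (Fin r) (Fin r) ℂ))ᵀ) := by
    rw [← Matrix.mul_assoc, ← sliceMatrix_mix]
    ext j x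
    simp [sliceMatrix, Matrix.mul_apply, Fintype.sum_prod_type, Matrix.one_apply, mul_comm]
  rw [h]
  exact (Matrix.rank_mul_le_right _ _).trans (Matrix.rank_mul_le_left _ _)

theorem rankB_image {m n : ℕ} {W : Matrix (Fin m) (Fin m) ℂ} {U : Matrix (Fin n) (Fin n) ℂ}
    (hW : IsUnit W.det) (hU : IsUnit U.det) (V : Submodule ℂ (Bip m n)) :
    rankB (image W U V) = rankB V := by
  refine le_antisymm (rankB_image_le _ _ _) ?_
  conv_lhs => rw [← image_inv_image hW hU V]
  exact rankB_image_le _ _ _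

theorem inv_mem_unitaryGroup {n : ℕ} {U : Matrix (Fin n) (Fin n) ℂ}
    (hU : U ∈ Matrix.unitaryGroup (Fin n) ℂ) : U⁻¹ ∈ Matrix.unitaryGroup (Fin n) ℂ := by
  rw [Matrix.inv_eq_left_inv (Matrix.mem_unitaryGroup_iff'.1 hU)]
  exact Unitary.star_mem hU

/-- The coefficient matrix of four two-by-two matrices in the standard basis. -/
def coordMatrix (M : Fin 4 → Matrix (Fin 2) (Fin 2) ℂ) : Matrix (Fin 4) (Fin 4) ℂ :=
  Matrix.of fun k => ![M k 0 0, M k 0 1, M k 1 0, M k 1 1]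

theorem rank_sliceMatrix_eq_four_iff (M : Fin 4 → Matrix (Fin 2) (Fin 2) ℂ) :
    (sliceMatrix M).rank = 4 ↔ (coordMatrix M).det ≠ 0 := by
  have h : coordMatrix M = (sliceMatrix M).submatrix (Equiv.refl _)
      (finProdFinEquiv (m := 2) (n := 2)).symm := by
    ext k j
    fin_cases j <;> rfl
  rw [← Matrix.rank_submatrix (sliceMatrix M) (Equiv.refl _)
    (finProdFinEquiv (m := 2) (n := 2)).symm, ← h]
  constructor
  · intro hr
    rw [Matrix.rank_eq_finrank_span_cols] at hr
    have : LinearIndependent ℂ (coordMatrix M).col := by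
      rw [linearIndependent_iff_card_eq_finrank_span, Fintype.card_fin]
      exact hr.symm
    exact ((Matrix.isUnit_iff_isUnit_det _).1
      (Matrix.linearIndependent_cols_iff_isUnit.1 this)).ne_zero
  · intro hd
    simpa using Matrix.rank_of_det_ne_zero hd

/-- `polarDet` is a nondegenerate form on the 2×2 matrices, so it cannot vanish identically on a
basis. -/
theorem gram_ne_zero_of_det_ne_zero {M : Fin 4 → Matrix (Fin 2) (Fin 2) ℂ}
    (hM : (coordMatrix M).det ≠ 0) : gram M ≠ 0 := by
  intro h
  have e : gram M = coordMatrix M * !![0, 0, 0, 1; 0, 0, -1, 0; 0, -1, 0, 0; 1, 0, 0, 0] *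
      (coordMatrix M)ᵀ := by
    ext i j
    simp [gram, polarDet_apply, coordMatrix, Matrix.mul_apply, Fin.sum_univ_four]
    ring
  have hJ : (!![0, 0, 0, 1; 0, 0, -1, 0; 0, -1, 0, 0; 1, 0, 0, 0] :
      Matrix (Fin 4) (Fin 4) ℂ).det = 1 := by
    simp [Matrix.det_succ_row_zero, Fin.sum_univ_succ, Fin.succAbove]
    norm_num
  have hd := congrArg Matrix.det e
  rw [h, Matrix.det_mul, Matrix.det_mul, hJ, Matrix.det_transpose, Matrix.det_zero] at hd
  exact hM (by simpa using hd.symm)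

theorem polarDet_vecMulVec (μ ν μ' ν' : Fin 2 → ℂ) :
    polarDet (Matrix.vecMulVec μ ν) (Matrix.vecMulVec μ' ν')
      = (μ 0 * μ' 1 - μ 1 * μ' 0) * (ν 0 * ν' 1 - ν 1 * ν' 0) := by
  simp only [polarDet_apply, Matrix.vecMulVec_apply]
  ring

/-- All four slices of the model are products: `|0⟩⊗|0⟩`, `|1⟩⊗|1⟩`, `a⊗b` and `c⊗d`. Hence it is EB
whatever the parameters. -/
theorem model4_eq (a b c d : Fin 2 → ℂ) : model4 a b c d = ofSlices fun j =>
    Matrix.vecMulVec (![![1, 0], ![0, 1], a, c] j) (![![1, 0], ![0, 1], b, d] j) := by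
  rw [ofSlices_two, model4]
  congr 2
  · ext ⟨i, j⟩
    fin_cases i <;> fin_cases j <;> simp [ket, Matrix.vecMulVec_apply, mul_comm]
  · congr 1
    ext ⟨i, j⟩
    fin_cases i <;> fin_cases j <;> simp [ket, Matrix.vecMulVec_apply] <;> ring

theorem isEB_model4 (a b c d : Fin 2 → ℂ) : IsEB (model4 a b c d) := by
  rw [model4_eq]
  exact isEB_ofSlices_vecMulVec _ _

theorem finrank_model4 (a b c d : Fin 2 → ℂ) : Module.finrank ℂ (model4 a b c d) = 2 := by
  rw [model4_eq]
  refine finrank_ofSlices ?_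
  rw [Fintype.linearIndependent_iff]
  intro w hw i
  have h0 := congrFun hw (0, 0)
  have h1 := congrFun hw (1, 1)
  simp [Matrix.vecMulVec_apply] at h0 h1
  fin_cases i <;> assumption

theorem rankB_model4_eq_four_iff (a b c d : Fin 2 → ℂ) : rankB (model4 a b c d) = 4 ↔
    Matrix.det !![a 0 * b 1, a 1 * b 0; c 0 * d 1, c 1 * d 0] ≠ 0 := by
  rw [model4_eq, rankB_ofSlices, rank_sliceMatrix_eq_four_iff, not_iff_not]
  have : ∀ x y : ℂ, x = y → (x = 0 ↔ y = 0) := fun x y h => by rw [h]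
  refine this _ _ ?_
  simp [coordMatrix, Matrix.det_succ_row_zero, Fin.sum_univ_succ, Fin.succAbove,
    Matrix.vecMulVec_apply]

theorem mul_vecMulVec_mul (W R : Matrix (Fin 2) (Fin 2) ℂ) (x y : Fin 2 → ℂ) :
    W * Matrix.vecMulVec x y * R = Matrix.vecMulVec (W *ᵥ x) (y ᵥ* R) := by
  rw [Matrix.mul_vecMulVec, Matrix.vecMulVec_mul]

theorem isEB_rankB_four_iff (T : Submodule ℂ (Bip 2 4)) :
    (Module.finrank ℂ T = 2 ∧ IsEB T ∧ rankB T = 4) ↔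
      ∃ a b c d : Fin 2 → ℂ, Matrix.det !![a 0 * b 1, a 1 * b 0; c 0 * d 1, c 1 * d 0] ≠ 0 ∧
        EBEquivalent (model4 a b c d) T := by
  constructor
  · rintro ⟨hT, hEB, hrank⟩
    obtain ⟨M, rfl, -⟩ := exists_eq_ofSlices T hT
    obtain ⟨U, hU, hU0⟩ := exists_mix_polarDet_eq_zero_of_four (isEB_ofSlices.1 hEB)
    choose μ ν _ hμν using fun k => exists_eq_vecMulVec (hU0 k)
    have hN : (coordMatrix (mix U M)).det ≠ 0 := by
      rw [← rank_sliceMatrix_eq_four_iff, sliceMatrix_mix, Matrix.rank_mul_eq_right_of_isUnit_det _ _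
        (isUnit_det_of_mem_unitaryGroup hU), ← rankB_ofSlices, hrank]
    -- By `polarDet_vecMulVec` a nonzero entry makes both `μ s, μ t` and `ν s, ν t` bases of `ℂ^2`.
    -- They become the standard ones through `W` on A and `R` on the basis of the subspace.
    obtain ⟨s, t, hst⟩ : ∃ s t, gram (mix U M) s t ≠ 0 := by
      by_contra! h
      exact gram_ne_zero_of_det_ne_zero hN (by ext s t; exact h s t)
    have hne : t ≠ s := by
      rintro rfl
      exact hst (hU0 t)
    let σ : Equiv.Perm (Fin 4) := Equiv.swap 0 s * Equiv.swap 1 (Equiv.swap 0 s t)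
    have hσ0 : σ 0 = s := by
      rw [Equiv.Perm.mul_apply, Equiv.swap_apply_of_ne_of_ne zero_ne_one, Equiv.swap_apply_left]
      intro h
      have := congrArg (Equiv.swap 0 s) h
      rw [Equiv.swap_apply_self, Equiv.swap_apply_left] at this
      exact hne this.symm
    have hσ1 : σ 1 = t := by simp [σ]
    rw [show gram (mix U M) s t = polarDet (mix U M s) (mix U M t) from rfl, hμν s, hμν t,
      polarDet_vecMulVec] at hst
    obtain ⟨h1, h2⟩ := mul_ne_zero_iff.1 hst
    let W : Matrix (Fin 2) (Fin 2) ℂ := !![μ s 0, μ t 0; μ s 1, μ t 1]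
    let R : Matrix (Fin 2) (Fin 2) ℂ := !![ν s 0, ν s 1; ν t 0, ν t 1]
    have hW : IsUnit W.det := by
      rw [isUnit_iff_ne_zero, Matrix.det_fin_two_of]
      convert h1 using 1
      ring
    have hR : IsUnit R.det := by
      rw [isUnit_iff_ne_zero, Matrix.det_fin_two_of]
      exact h2
    let U' := U.submatrix σ id
    have hU' : U' ∈ Matrix.unitaryGroup (Fin 4) ℂ :=
      submatrix_mem_unitaryGroup hU σ (Equiv.refl _)
    have hmodel : image 1 U' (ofSlices M) = image W 1 (model4 (W⁻¹ *ᵥ μ (σ 2)) (ν (σ 2) ᵥ* R⁻¹)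
        (W⁻¹ *ᵥ μ (σ 3)) (ν (σ 3) ᵥ* R⁻¹)) := by
      rw [model4_eq, image_ofSlices, image_ofSlices, mix_submatrix, mix_one]
      refine Eq.trans ?_ (ofSlices_mul _ R hR)
      congr 1
      funext j
      rw [mul_vecMulVec_mul, Matrix.one_mul, Function.comp, hμν]
      congr 1
      · fin_cases j
        · simp only [Fin.zero_eta, hσ0]
          ext i
          fin_cases i <;> simp [W, Matrix.mulVec, dotProduct]
        · simp only [Fin.mk_one, hσ1]
          ext i
          fin_cases i <;> simp [W, Matrix.mulVec, dotProduct]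
        · change μ (σ 2) = W *ᵥ (W⁻¹ *ᵥ μ (σ 2))
          rw [Matrix.mulVec_mulVec, Matrix.mul_nonsing_inv _ hW, Matrix.one_mulVec]
        · change μ (σ 3) = W *ᵥ (W⁻¹ *ᵥ μ (σ 3))
          rw [Matrix.mulVec_mulVec, Matrix.mul_nonsing_inv _ hW, Matrix.one_mulVec]
      · fin_cases j
        · simp only [Fin.zero_eta, hσ0]
          ext i
          fin_cases i <;> simp [R, Matrix.vecMul, dotProduct]
        · simp only [Fin.mk_one, hσ1]
          ext i
          fin_cases i <;> simp [R, Matrix.vecMul, dotProduct]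
        · simp [Matrix.vecMul_vecMul, Matrix.nonsing_inv_mul _ hR]
        · simp [Matrix.vecMul_vecMul, Matrix.nonsing_inv_mul _ hR]
    have hT' : ofSlices M = image W U'⁻¹ (model4 (W⁻¹ *ᵥ μ (σ 2)) (ν (σ 2) ᵥ* R⁻¹)
        (W⁻¹ *ᵥ μ (σ 3)) (ν (σ 3) ᵥ* R⁻¹)) := by
      rw [← image_inv_image (W := 1) (by simp) (isUnit_det_of_mem_unitaryGroup hU') (ofSlices M),
        hmodel, image_image, inv_one, Matrix.one_mul, Matrix.mul_one]
    have hUi := inv_mem_unitaryGroup hU'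
    refine ⟨_, _, _, _, ?_, W, U'⁻¹, (Matrix.isUnit_iff_isUnit_det _).2 hW, hUi, hT'⟩
    rw [hT', rankB_image hW (isUnit_det_of_mem_unitaryGroup hUi)] at hrank
    exact (rankB_model4_eq_four_iff _ _ _ _).1 hrank
  · rintro ⟨a, b, c, d, hdet, W, U, hW, hU, rfl⟩
    rw [Matrix.isUnit_iff_isUnit_det] at hW
    have hUd := isUnit_det_of_mem_unitaryGroup hU
    refine ⟨?_, (isEB_model4 a b c d).image W hU, ?_⟩
    · rw [finrank_image hW hUd, finrank_model4]
    · rw [rankB_image hW hUd, rankB_model4_eq_four_iff]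
      exact hdet

/-! ### Separability of the third model -/

theorem proj_apply {ι : Type*} (v : ι → ℂ) (i j : ι) : proj v i j = v i * star (v j) := rfl

/-- The partial transpose on the second factor. -/
def partialTranspose {α β : Type*} (ρ : Matrix (α × β) (α × β) ℂ) :
    Matrix (α × β) (α × β) ℂ :=
  Matrix.of fun x y => ρ (x.1, y.2) (y.1, x.2)

open scoped ComplexOrder in
theorem IsSeparable.posSemidef_partialTranspose {α β : Type*} [Fintype α] [Fintype β]
    {ρ : Matrix (α × β) (α × β) ℂ} (h : IsSeparable ρ) : (partialTranspose ρ).PosSemidef := by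
  obtain ⟨N, μ, ν, rfl⟩ := isSeparable_iff.1 h
  have e : partialTranspose (slicesState fun s => Matrix.vecMulVec (μ s) (ν s))
      = ∑ s, Matrix.vecMulVec (fun x : α × β => μ s x.1 * star (ν s x.2))
        (star fun x : α × β => μ s x.1 * star (ν s x.2)) := by
    ext x y
    simp only [partialTranspose, Matrix.of_apply, slicesState_apply, Matrix.sum_apply,
      Matrix.vecMulVec_apply, Pi.star_apply, star_mul', star_star]
    exact Finset.sum_congr rfl fun s _ => by ring
  rw [e]
  exact Matrix.posSemidef_sum _ fun s _ => Matrix.posSemidef_vecMulVec_self_star _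

theorem IsSeparable.add {α β : Type*} {ρ σ : Matrix (α × β) (α × β) ℂ} (hρ : IsSeparable ρ)
    (hσ : IsSeparable σ) : IsSeparable (ρ + σ) := by
  obtain ⟨N, q, μ, ν, hq, rfl⟩ := hρ
  obtain ⟨N', q', μ', ν', hq', rfl⟩ := hσ
  refine ⟨N + N', Fin.append q q', Fin.append μ μ', Fin.append ν ν', fun s => ?_, ?_⟩
  · refine Fin.addCases (fun i => ?_) (fun i => ?_) s
    · rw [Fin.append_left]; exact hq i
    · rw [Fin.append_right]; exact hq' i
  · rw [Fin.sum_univ_add]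
    simp only [Fin.append_left, Fin.append_right]

theorem isSeparable_smul_kronecker {α β : Type*} {q : ℝ} (hq : 0 ≤ q) (u : α → ℂ) (v : β → ℂ) :
    IsSeparable ((q : ℂ) • (proj u ⊗ₖ proj v)) :=
  ⟨1, fun _ => q, fun _ => u, fun _ => v, fun _ => hq, by simp⟩

/-- The Hermitian two-by-two matrix with diagonal `x, w` and upper right entry `z`. -/
def herm (x w : ℝ) (z : ℂ) : Matrix (Fin 2) (Fin 2) ℂ := !![(x : ℂ), z; star z, (w : ℂ)]

/-- A singular Hermitian matrix is a real multiple of a projector; in the tensor square the sign of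
this multiple disappears. -/
theorem isSeparable_herm_kronecker_self {x w : ℝ} {z : ℂ} (h : x * w = Complex.normSq z) :
    IsSeparable (herm x w z ⊗ₖ herm x w z) := by
  by_cases hx : x = 0
  · subst hx
    have hz : z = 0 := by
      rw [zero_mul] at h
      exact Complex.normSq_eq_zero.1 h.symm
    subst hz
    convert isSeparable_smul_kronecker (sq_nonneg w) (![0, 1] : Fin 2 → ℂ) (![0, 1] : Fin 2 → ℂ)
      using 1
    ext ⟨i, j⟩ ⟨k, l⟩
    fin_cases i <;> fin_cases j <;> fin_cases k <;> fin_cases l <;>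
      simp [herm, proj_apply, pow_two]
  · have hxc : (x : ℂ) ≠ 0 := by exact_mod_cast hx
    have hw : (w : ℂ) = z * star z / x := by
      rw [eq_div_iff hxc, RCLike.star_def, Complex.mul_conj, ← h]
      push_cast
      ring
    convert isSeparable_smul_kronecker (inv_nonneg.2 (sq_nonneg x)) (![(x : ℂ), star z])
      (![(x : ℂ), star z]) using 1
    have e : herm x w z = (x : ℂ)⁻¹ • proj ![(x : ℂ), star z] := by
      ext i j
      fin_cases i <;> fin_cases j <;> simp [herm, proj_apply, hxc, hw]
      · field_simp
      · ring
    rw [e, Matrix.smul_kronecker, Matrix.kronecker_smul, smul_smul]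
    congr 1
    push_cast
    ring

/-- The coefficients `a` and `e` have opposite signs, so the quadratic in `c / s` has a nonnegative
discriminant; a root is then normalized. -/
theorem exists_rotation_root {a b e : ℝ} (ha : 0 ≤ a) (he : e ≤ 0) :
    ∃ c s : ℝ, c ^ 2 + s ^ 2 = 1 ∧ c ^ 2 * a + c * s * b + s ^ 2 * e = 0 := by
  rcases ha.eq_or_lt with rfl | ha
  · exact ⟨1, 0, by norm_num, by norm_num⟩
  have hd : 0 ≤ discrim a b e := by
    rw [discrim]
    nlinarith [sq_nonneg b, mul_nonneg ha.le (neg_nonneg.2 he)]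
  obtain ⟨r, hr⟩ := exists_quadratic_eq_zero ha.ne' ⟨√(discrim a b e), (Real.mul_self_sqrt hd).symm⟩
  have hn : 0 < r ^ 2 + 1 := by positivity
  obtain ⟨n, hn0, hn2⟩ : ∃ n : ℝ, n ≠ 0 ∧ n ^ 2 = r ^ 2 + 1 :=
    ⟨√(r ^ 2 + 1), (Real.sqrt_pos.2 hn).ne', Real.sq_sqrt hn.le⟩
  refine ⟨r / n, 1 / n, ?_, ?_⟩
  · field_simp
    exact hn2.symm
  · field_simp
    linear_combination hr

theorem herm_add (x w x' w' : ℝ) (z z' : ℂ) (c s : ℝ) :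
    (c : ℂ) • herm x w z + (s : ℂ) • herm x' w' z'
      = herm (c * x + s * x') (c * w + s * w') (c * z + s * z') := by
  ext i j
  fin_cases i <;> fin_cases j <;> simp [herm]

/-- Two Hermitian matrices of determinants of opposite signs can be rotated so that the first
one becomes singular. -/
theorem exists_rotate_herm {x w x' w' : ℝ} {z z' : ℂ} (h : 0 ≤ x * w - Complex.normSq z)
    (h' : x' * w' - Complex.normSq z' ≤ 0) : ∃ (y v y' v' : ℝ) (u u' : ℂ),
      y * v = Complex.normSq u ∧
      y' * v' - Complex.normSq u'
        = x * w - Complex.normSq z + (x' * w' - Complex.normSq z') ∧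
      herm x w z ⊗ₖ herm x w z + herm x' w' z' ⊗ₖ herm x' w' z'
        = herm y v u ⊗ₖ herm y v u + herm y' v' u' ⊗ₖ herm y' v' u' := by
  -- The quadratic form is `det (c H + s H')`. Rotating the pair `H, H'` preserves both `H ⊗ H + H'
  -- ⊗ H'` and the sum of the determinants.
  obtain ⟨c, s, hcs, hr⟩ := exists_rotation_root
    (b := x * w' + x' * w - 2 * (z.re * z'.re + z.im * z'.im)) h h'
  rw [Complex.normSq_apply, Complex.normSq_apply] at hr
  refine ⟨c * x + s * x', c * w + s * w', -s * x + c * x', -s * w + c * w', c * z + s * z',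
    ((-s : ℝ) : ℂ) * z + c * z', ?_, ?_, ?_⟩
  · simp [Complex.normSq_apply]
    linear_combination hr
  · simp [Complex.normSq_apply]
    linear_combination (x * w - (z.re * z.re + z.im * z.im)
      + (x' * w' - (z'.re * z'.re + z'.im * z'.im))) * hcs - hr
  · rw [← herm_add, ← herm_add]
    have hcs' : (c : ℂ) ^ 2 + (s : ℂ) ^ 2 = 1 := by exact_mod_cast hcs
    ext ⟨i, j⟩ ⟨k, l⟩
    simp only [Matrix.add_apply, Matrix.kroneckerMap_apply, Matrix.smul_apply, smul_eq_mul]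
    push_cast
    linear_combination -(herm x w z i k * herm x w z j l + herm x' w' z' i k * herm x' w' z' j l)
      * hcs'

/-- The slices of the third model space. -/
def triSlices (d g : ℝ) (h : ℂ) : Fin 3 → Matrix (Fin 2) (Fin 2) ℂ :=
  ![!![1, 0; 0, (d : ℂ)], !![0, 1; 1, h], !![0, 0; 0, (g : ℂ)]]

-- The expression is the determinant of the partial transpose, which is positive semidefinite for a
-- separable state.
open scoped ComplexOrder in
theorem nonneg_of_isSeparable_triSlices {d g : ℝ} {h : ℂ}
    (hs : IsSeparable (slicesState (triSlices d g h))) :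
    0 ≤ -1 - (h.re ^ 2 + h.im ^ 2) + g ^ 2
      - d ^ 2 * (-2 + d ^ 2 + (h.re ^ 2 + h.im ^ 2) + g ^ 2)
      + 2 * d * (h.re ^ 2 - h.im ^ 2) := by
  have hp := (hs.posSemidef_partialTranspose.submatrix
    (finProdFinEquiv (m := 2) (n := 2)).symm).det_nonneg
  have e : (partialTranspose (slicesState (triSlices d g h))).submatrix
      (finProdFinEquiv (m := 2) (n := 2)).symm (finProdFinEquiv (m := 2) (n := 2)).symm
      = !![1, 0, 0, 1; 0, 1, (d : ℂ), star h; 0, (d : ℂ), 1, h;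
        1, h, star h, (d : ℂ) ^ 2 + h * star h + (g : ℂ) ^ 2] := by
    ext i j
    fin_cases i <;> fin_cases j <;>
      simp [partialTranspose, slicesState_apply, triSlices, Fin.sum_univ_three, finProdFinEquiv,
        Fin.divNat, Fin.modNat, pow_two]
  rw [e] at hp
  have hd : Matrix.det !![1, 0, 0, 1; 0, 1, (d : ℂ), star h; 0, (d : ℂ), 1, h;
        1, h, star h, (d : ℂ) ^ 2 + h * star h + (g : ℂ) ^ 2]
      = ((-1 - (h.re ^ 2 + h.im ^ 2) + g ^ 2
      - d ^ 2 * (-2 + d ^ 2 + (h.re ^ 2 + h.im ^ 2) + g ^ 2)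
      + 2 * d * (h.re ^ 2 - h.im ^ 2) : ℝ) : ℂ) := by
    have e1 : h = h.re + h.im * Complex.I := (Complex.re_add_im h).symm
    have e2 : star h = h.re - h.im * Complex.I := by
      apply Complex.ext <;> simp
    rw [e2]
    generalize h.re = p at *
    generalize h.im = q at *
    subst e1
    simp [Matrix.det_succ_row_zero, Fin.sum_univ_succ, Fin.succAbove]
    linear_combination (q : ℂ) ^ 2 * (d + 1) ^ 2 * Complex.I_sq
  rw [hd] at hp
  exact_mod_cast hp

theorem isSeparable_triSlices {d g : ℝ} {h : ℂ} (hd : 0 ≤ d) (hg : 0 < g)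
    (hc : 0 ≤ -1 - (h.re ^ 2 + h.im ^ 2) + g ^ 2
      - d ^ 2 * (-2 + d ^ 2 + (h.re ^ 2 + h.im ^ 2) + g ^ 2)
      + 2 * d * (h.re ^ 2 - h.im ^ 2)) :
    IsSeparable (slicesState (triSlices d g h)) := by
  obtain ⟨p, q, rfl⟩ : ∃ p q : ℝ, h = p + q * Complex.I := ⟨_, _, (Complex.re_add_im h).symm⟩
  simp only [Complex.add_re, Complex.ofReal_re, Complex.mul_re, Complex.I_re, mul_zero,
    Complex.ofReal_im, Complex.I_im, mul_one, sub_self, add_zero, Complex.add_im, Complex.mul_im,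
    zero_add] at hc
  -- The expression in `hc` equals `(1-d²)g² - (1-d²)² - (1-d)²p² - (1+d)²q²`, which is negative for
  -- `d > 1`.
  have hd1 : d ≤ 1 := by
    by_contra! hlt
    nlinarith [mul_pos (sub_pos.2 hlt) (pow_pos hg 2), mul_nonneg (sub_pos.2 hlt).le (sq_nonneg p),
      sq_nonneg q, mul_nonneg hd (sq_nonneg q), mul_pos (sub_pos.2 hlt) (sub_pos.2 hlt),
      mul_nonneg (mul_nonneg hd (sub_pos.2 hlt).le) (sq_nonneg p)]
  obtain ⟨α, hα0, hα⟩ : ∃ α : ℝ, 0 < α ∧ α ^ 2 = (1 + d) / 2 :=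
    ⟨√((1 + d) / 2), Real.sqrt_pos.2 (by linarith), Real.sq_sqrt (by linarith)⟩
  obtain ⟨β, hβ0, hβ⟩ : ∃ β : ℝ, 0 ≤ β ∧ β ^ 2 = (1 - d) / 2 :=
    ⟨√((1 - d) / 2), Real.sqrt_nonneg _, Real.sq_sqrt (by linarith)⟩
  obtain ⟨t, ht⟩ : ∃ t : ℝ, α * t = p := ⟨p / α, by field_simp⟩
  -- For `d < 1` the quantity in `hpos` is the expression in `hc` divided by `1 - d²`. For `d = 1`
  -- the hypothesis forces `q = 0`, `β` vanishes, and `t' = 0` works.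
  obtain ⟨t', ht', hpos⟩ : ∃ t' : ℝ, β * t' = -q ∧
      0 ≤ d ^ 2 + (p ^ 2 + q ^ 2) + g ^ 2 - 1 - t ^ 2 - t' ^ 2 := by
    rcases hd1.eq_or_lt with rfl | hlt
    · have hq : q = 0 := by nlinarith
      have hα1 : α = 1 := by nlinarith
      subst hq hα1
      refine ⟨0, by simp, ?_⟩
      rw [one_mul] at ht
      rw [ht]
      nlinarith [sq_nonneg g]
    · have hβp : 0 < β ^ 2 := by rw [hβ]; linarith
      have hβ1 : β ≠ 0 := by
        rintro rfl
        simp at hβp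
      refine ⟨-q / β, by field_simp, ?_⟩
      have e1 : t ^ 2 * (1 + d) = 2 * p ^ 2 := by rw [← ht]; linear_combination -2 * t ^ 2 * hα
      have e2 : (-q / β) ^ 2 * (1 - d) = 2 * q ^ 2 := by
        have : (-q / β) ^ 2 * β ^ 2 = q ^ 2 := by field_simp
        rw [hβ] at this
        linear_combination 2 * this
      have hfac : 0 < (1 - d) * (1 + d) := mul_pos (by linarith) (by linarith)
      refine (mul_nonneg_iff_of_pos_left hfac).1 ?_
      refine hc.trans_eq ?_
      linear_combination (1 - d) * e1 + (1 + d) * e2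
  obtain ⟨t'', ht''⟩ : ∃ t'' : ℝ,
      t'' ^ 2 = d ^ 2 + (p ^ 2 + q ^ 2) + g ^ 2 - 1 - t ^ 2 - t' ^ 2 := 
    ⟨√(d ^ 2 + (p ^ 2 + q ^ 2) + g ^ 2 - 1 - t ^ 2 - t' ^ 2), Real.sq_sqrt hpos⟩
  -- The determinants of the four Hermitian matrices are `1`, `-α²`, `-β²` and `0`, with sum zero
  -- since `α² + β² = 1`.
  have key : slicesState (triSlices d g (p + q * Complex.I))
      = herm 1 1 0 ⊗ₖ herm 1 1 0 + herm 0 t α ⊗ₖ herm 0 t α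
        + herm 0 t' (β * Complex.I) ⊗ₖ herm 0 t' (β * Complex.I)
        + herm 0 t'' 0 ⊗ₖ herm 0 t'' 0 := by
    have c1 : (α : ℂ) ^ 2 = (1 + d) / 2 := by exact_mod_cast congrArg Complex.ofReal hα
    have c2 : (β : ℂ) ^ 2 = (1 - d) / 2 := by exact_mod_cast congrArg Complex.ofReal hβ
    have c3 : (α : ℂ) * t = p := by exact_mod_cast congrArg Complex.ofReal ht
    have c4 : (β : ℂ) * t' = -q := by exact_mod_cast congrArg Complex.ofReal ht'
    have c5 : (t'' : ℂ) ^ 2 = d ^ 2 + (p ^ 2 + q ^ 2) + g ^ 2 - 1 - t ^ 2 - t' ^ 2 := by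
      exact_mod_cast congrArg Complex.ofReal ht''
    have hI := Complex.I_sq
    ext ⟨i, j⟩ ⟨k, l⟩
    fin_cases i <;> fin_cases j <;> fin_cases k <;> fin_cases l <;>
      simp [slicesState_apply, triSlices, Fin.sum_univ_three, herm] <;>
      first
      | linear_combination -c1 + c2 - (β : ℂ) ^ 2 * hI
      | linear_combination -c1 - c2 + (β : ℂ) ^ 2 * hI
      | linear_combination -c3 - Complex.I * c4
      | linear_combination -c3 + Complex.I * c4
      | linear_combination -c5 - (q : ℂ) ^ 2 * hI
  -- The first rotation changes the determinants `1, -α²` into `0, β²`; the second then changes `β²,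
  -- -β²` into `0, 0`.
  obtain ⟨y, v, y', v', u, u', s1, s2, s3⟩ := exists_rotate_herm (x := 1) (w := 1) (z := 0)
    (x' := 0) (w' := t) (z' := (α : ℂ)) (by simp) (by simp [← pow_two, sq_nonneg])
  have n1 : Complex.normSq (α : ℂ) = (1 + d) / 2 := by
    rw [Complex.normSq_ofReal, ← pow_two, hα]
  have n2 : Complex.normSq ((β : ℂ) * Complex.I) = (1 - d) / 2 := by
    rw [Complex.normSq_mul, Complex.normSq_I, mul_one, Complex.normSq_ofReal, ← pow_two, hβ]
  rw [n1, Complex.normSq_zero] at s2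
  obtain ⟨y₂, v₂, y₂', v₂', w, w', r1, r2, r3⟩ := exists_rotate_herm (x := y') (w := v') (z := u')
    (x' := 0) (w' := t') (z' := (β : ℂ) * Complex.I) (by rw [s2]; linarith)
    (by rw [n2]; linarith)
  rw [n2, s2] at r2
  rw [key, s3, add_assoc (herm y v u ⊗ₖ herm y v u), r3]
  refine ((isSeparable_herm_kronecker_self s1).add ((isSeparable_herm_kronecker_self r1).add
    (isSeparable_herm_kronecker_self ?_))).add (isSeparable_herm_kronecker_self ?_)
  · linarith
  · simp

/-! ### Model spaces and product slices -/

/-- The span of the columns of `∑ |k, k⟩ ⊗ e k`. -/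
def diagModel (e : Fin 3 → Fin 2 → ℂ) : Submodule ℂ (Bip 3 3) :=
  ofSlices fun k => Matrix.vecMulVec (Pi.single k 1) (e k)

theorem isEB_diagModel (e : Fin 3 → Fin 2 → ℂ) : IsEB (diagModel e) :=
  isEB_ofSlices_vecMulVec _ _

theorem diagModel_parallel : diagModel ![![1, 0], ![0, 1], ![0, 1]]
    = Submodule.span ℂ {ket 0 0, ket 1 1 + ket 2 2} := by
  rw [diagModel, ofSlices_two]
  congr 2
  · ext ⟨i, j⟩
    fin_cases i <;> fin_cases j <;> simp [ket, Matrix.vecMulVec_apply]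
  · congr 1
    ext ⟨i, j⟩
    fin_cases i <;> fin_cases j <;> simp [ket, Matrix.vecMulVec_apply]

theorem diagModel_generic : diagModel ![![1, 0], ![1, 1], ![0, 1]]
    = Submodule.span ℂ {ket 0 0 + ket 1 1, ket 1 1 + ket 2 2} := by
  rw [diagModel, ofSlices_two]
  congr 2
  · ext ⟨i, j⟩
    fin_cases i <;> fin_cases j <;> simp [ket, Matrix.vecMulVec_apply]
  · congr 1
    ext ⟨i, j⟩
    fin_cases i <;> fin_cases j <;> simp [ket, Matrix.vecMulVec_apply]

/-- The coordinate inclusion `ℂ^2 ⊆ ℂ^3`. -/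
def inclTwoThree : Matrix (Fin 3) (Fin 2) ℂ := !![1, 0; 0, 1; 0, 0]

theorem inclTwoThree_transpose_mul : inclTwoThreeᵀ * inclTwoThree = 1 := by
  ext i j
  fin_cases i <;> fin_cases j <;> simp [inclTwoThree, Matrix.mul_apply, Fin.sum_univ_three]

theorem image_triSlices (d g : ℝ) (h : ℂ) : image (n' := 3) inclTwoThree 1 (ofSlices (triSlices d g h))
    = Submodule.span ℂ {ket 0 0 + ket 1 1,
      ket 0 1 + ((d : ℂ) • ket 1 0 + h • ket 1 1 + (g : ℂ) • ket 1 2)} := by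
  rw [image_ofSlices, ofSlices_two, mix_one]
  congr 2
  · ext ⟨i, j⟩
    fin_cases i <;> fin_cases j <;>
      simp [ket, Matrix.mul_apply, inclTwoThree, triSlices]
  · congr 1
    ext ⟨i, j⟩
    fin_cases i <;> fin_cases j <;>
      simp [ket, Matrix.mul_apply, inclTwoThree, triSlices]

theorem isModel3_expression (d f θ g : ℝ) :
    -1 - f ^ 2 + g ^ 2 - d ^ 2 * (-2 + d ^ 2 + f ^ 2 + g ^ 2) + 2 * d * f ^ 2 * Real.cos (2 * θ)
      = -1 - ((f * Complex.exp (Complex.I * θ)).re ^ 2 + (f * Complex.exp (Complex.I * θ)).im ^ 2)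
        + g ^ 2 - d ^ 2 * (-2 + d ^ 2 + ((f * Complex.exp (Complex.I * θ)).re ^ 2
          + (f * Complex.exp (Complex.I * θ)).im ^ 2) + g ^ 2)
        + 2 * d * ((f * Complex.exp (Complex.I * θ)).re ^ 2
          - (f * Complex.exp (Complex.I * θ)).im ^ 2) := by
  have h1 : (f * Complex.exp (Complex.I * θ)).re = f * Real.cos θ := by
    rw [mul_comm Complex.I, Complex.re_ofReal_mul, Complex.exp_ofReal_mul_I_re]
  have h2 : (f * Complex.exp (Complex.I * θ)).im = f * Real.sin θ := by
    rw [mul_comm Complex.I, Complex.im_ofReal_mul, Complex.exp_ofReal_mul_I_im]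
  rw [h1, h2, Real.cos_two_mul]
  linear_combination (-f ^ 2 - d ^ 2 * f ^ 2 - 2 * d * f ^ 2) * -Real.sin_sq_add_cos_sq θ

theorem IsModel3.isEB {S : Submodule ℂ (Bip 3 3)} (hS : IsModel3 S) : IsEB S := by
  rcases hS with rfl | rfl | ⟨d, f, θ, g, hd, -, -, hg, hc, rfl⟩
  · rw [← diagModel_parallel]
    exact isEB_diagModel _
  · rw [← diagModel_generic]
    exact isEB_diagModel _
  · rw [← image_triSlices]
    rw [isModel3_expression] at hc
    exact (isEB_ofSlices.2 (isSeparable_triSlices hd hg hc)).image _ (one_mem _)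

theorem isModel3_image_triSlices {d g : ℝ} {h : ℂ} (hd : 0 ≤ d) (hg : 0 < g)
    (hEB : IsEB (ofSlices (triSlices d g h))) :
    IsModel3 (image (n' := 3) inclTwoThree 1 (ofSlices (triSlices d g h))) := by
  obtain ⟨θ, hθ, hh⟩ : ∃ θ : ℝ, 0 ≤ θ ∧ h = ‖h‖ * Complex.exp (Complex.I * θ) := by
    -- The full turn makes the angle nonnegative, as the model requires.
    refine ⟨Complex.arg h + 2 * Real.pi, by linarith [Complex.neg_pi_lt_arg h, Real.pi_pos], ?_⟩
    conv_lhs => rw [← Complex.norm_mul_exp_arg_mul_I h]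
    have : Complex.I * ((Complex.arg h + 2 * Real.pi : ℝ) : ℂ)
        = Complex.arg h * Complex.I + 2 * Real.pi * Complex.I := by
      push_cast
      ring
    rw [this, Complex.exp_periodic]
  have hc := nonneg_of_isSeparable_triSlices (isEB_ofSlices.1 hEB)
  refine Or.inr (Or.inr ⟨d, ‖h‖, θ, g, hd, norm_nonneg _, hθ, hg, ?_, ?_⟩)
  · rw [isModel3_expression, ← hh]
    exact hc
  · rw [image_triSlices, ← hh]

/-- The A-vectors `μ` and the scalars `c` are absorbed into the columns of `W`, which need not be
invertible, and `R` into the basis. Only the `ν k` matter, up to order, scaling and a common linear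
map. -/
theorem ebConvertible_diagModel {M : Fin 3 → Matrix (Fin 2) (Fin 2) ℂ}
    {U : Matrix (Fin 3) (Fin 3) ℂ} (hU : U ∈ Matrix.unitaryGroup (Fin 3) ℂ)
    {μ ν : Fin 3 → Fin 2 → ℂ} (hμν : ∀ k, mix U M k = Matrix.vecMulVec (μ k) (ν k))
    (σ : Equiv.Perm (Fin 3)) (c : Fin 3 → ℂ) {R : Matrix (Fin 2) (Fin 2) ℂ} (hR : IsUnit R.det)
    {e : Fin 3 → Fin 2 → ℂ} (he : ∀ k, ν (σ k) = c k • (e k ᵥ* R)) :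
    EBConvertible (diagModel e) (ofSlices M) := by
  have hU' : U.submatrix σ id ∈ Matrix.unitaryGroup (Fin 3) ℂ :=
    submatrix_mem_unitaryGroup hU σ (Equiv.refl _)
  refine ⟨Matrix.of fun a k => c k * μ (σ k) a, (U.submatrix σ id)⁻¹, inv_mem_unitaryGroup hU', ?_⟩
  have key : image 1 (U.submatrix σ id) (ofSlices M)
      = image (Matrix.of fun a k => c k * μ (σ k) a) 1 (diagModel e) := by
    rw [diagModel, image_ofSlices, image_ofSlices, mix_submatrix, mix_one]
    refine Eq.trans ?_ (ofSlices_mul _ R hR)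
    congr 1
    funext k
    rw [Matrix.one_mul, Function.comp, hμν, he, Matrix.mul_vecMulVec, Matrix.vecMulVec_mul]
    ext a b
    simp [Matrix.vecMulVec_apply]
    ring
  rw [← image_inv_image (W := 1) (by simp) (isUnit_det_of_mem_unitaryGroup hU') (ofSlices M),
    key, image_image, inv_one, Matrix.one_mul, Matrix.mul_one]

theorem exists_ebConvertible_of_product {M : Fin 3 → Matrix (Fin 2) (Fin 2) ℂ}
    (hM : Module.finrank ℂ (ofSlices M) = 2)
    {U : Matrix (Fin 3) (Fin 3) ℂ} (hU : U ∈ Matrix.unitaryGroup (Fin 3) ℂ)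
    (hU0 : ∀ k, polarDet (mix U M k) (mix U M k) = 0) :
    ∃ S, IsModel3 S ∧ EBConvertible S (ofSlices M) := by
  choose μ ν hν hμν using fun k => exists_eq_vecMulVec (hU0 k)
  let n : Fin 3 → Fin 3 → ℂ := fun i j => ν i 0 * ν j 1 - ν i 1 * ν j 0
  have hn : ∀ i j, n i j = -n j i := fun i j => by simp only [n]; ring
  have hdet : ∀ i j, (Matrix.of ![ν i, ν j]).det = n i j := fun i j => by
    rw [Matrix.det_fin_two]
    rfl
  -- Cramer's relation between three vectors of the plane.
  have hcr : ∀ i j l, n i j • ν l = n l j • ν i + n i l • ν j := fun i j l => by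
    ext a
    fin_cases a <;> simp [n] <;> ring
  -- If all `ν k` were parallel to `ν 0`, the two spanning vectors would be dependent.
  have hnot : ¬ (n 0 1 = 0 ∧ n 0 2 = 0) := by
    rintro ⟨h1, h2⟩
    have hli := linearIndependent_of_finrank_ofSlices
      (M := mix U M) (by
        have h := finrank_image (m := 2) (W := 1) (by simp) (isUnit_det_of_mem_unitaryGroup hU)
          (ofSlices M)
        rw [image_ofSlices, hM] at h
        have e : (fun j => (1 : Matrix (Fin 2) (Fin 2) ℂ) * mix U M j) = mix U M :=
          funext fun j => Matrix.one_mul _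
        rwa [e] at h)
    rw [Fintype.linearIndependent_iff] at hli
    have hk : ∀ k, ν 0 1 * ν k 0 - ν 0 0 * ν k 1 = 0 := by
      intro k
      fin_cases k
      · simp; ring
      · simp only [n] at h1
        simp; linear_combination -h1
      · simp only [n] at h2
        simp; linear_combination -h2
    have h0 := hli ![ν 0 1, -ν 0 0] (by
      ext ⟨a, k⟩
      simp [hμν, Fin.sum_univ_two, Matrix.vecMulVec_apply]
      linear_combination μ k a * hk k)
    refine hν 0 ?_
    ext i
    fin_cases i
    · simpa using h0 1
    · simpa using h0 0
  by_cases hgen : n 0 1 ≠ 0 ∧ n 0 2 ≠ 0 ∧ n 1 2 ≠ 0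
  · obtain ⟨h01, h02, h12⟩ := hgen
    refine ⟨_, Or.inr (Or.inl rfl), ?_⟩
    rw [← diagModel_generic]
    have hx : n 1 2 / n 0 2 ≠ 0 := div_ne_zero h12 h02
    have hy : n 0 1 / n 0 2 ≠ 0 := div_ne_zero h01 h02
    -- The rows of `R` are `ν 0` and `ν 2` rescaled by Cramer's relation so that their sum is `ν 1`.
    refine ebConvertible_diagModel hU hμν (Equiv.refl _) ![n 0 2 / n 1 2, 1, n 0 2 / n 0 1]
      (R := Matrix.of ![(n 1 2 / n 0 2) • ν 0, (n 0 1 / n 0 2) • ν 2]) ?_ ?_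
    · rw [isUnit_iff_ne_zero]
      have : (Matrix.of ![(n 1 2 / n 0 2) • ν 0, (n 0 1 / n 0 2) • ν 2]).det
          = (n 1 2 / n 0 2) * (n 0 1 / n 0 2) * n 0 2 := by
        rw [Matrix.det_fin_two]
        simp
        simp only [n]
        ring
      rw [this]
      exact mul_ne_zero (mul_ne_zero hx hy) h02
    · intro k
      fin_cases k
      · ext a
        simp
        field_simp
      · ext a
        have := congrFun (hcr 0 2 1) a
        simp at this
        simp
        field_simp
        linear_combination this
      · ext a
        simp
        field_simp
  · obtain ⟨i, j, l, hij, hil, hjl, h1, h2⟩ : ∃ i j l : Fin 3, i ≠ j ∧ i ≠ l ∧ j ≠ l ∧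
        n i j ≠ 0 ∧ n l j = 0 := by
      by_cases h01 : n 0 1 = 0
      · exact ⟨2, 0, 1, by decide, by decide, by decide, by
          rw [hn, neg_ne_zero]; tauto, by rw [hn, h01, neg_zero]⟩
      by_cases h02 : n 0 2 = 0
      · exact ⟨1, 0, 2, by decide, by decide, by decide, by
          rw [hn, neg_ne_zero]; exact h01, by rw [hn, h02, neg_zero]⟩
      · exact ⟨0, 1, 2, by decide, by decide, by decide, h01, by rw [hn, neg_eq_zero]; tauto⟩
    refine ⟨_, Or.inl rfl, ?_⟩
    rw [← diagModel_parallel]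
    obtain ⟨σ, hσ0, hσ1, hσ2⟩ : ∃ σ : Equiv.Perm (Fin 3), σ 0 = i ∧ σ 1 = j ∧ σ 2 = l := by
      clear h1 h2
      revert i j l
      decide
    refine ebConvertible_diagModel hU hμν σ ![1, 1, n i l / n i j]
      (R := Matrix.of ![ν i, ν j]) ?_ ?_
    · rw [hdet, isUnit_iff_ne_zero]
      exact h1
    · intro k
      fin_cases k
      · ext a
        simp [hσ0]
      · ext a
        simp [hσ1]
      · ext a
        have := congrFun (hcr i j l) a
        simp [h2] at this
        simp [hσ2]
        field_simp
        linear_combination this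

/-! ### Nondegenerate Gram matrix: reduction to the third model -/

/-- This is QR: the rows of `U` are conjugates of the vectors obtained by Gram–Schmidt from the
columns of `K`. -/
theorem exists_unitary_mul_upperTriangular {n : ℕ} (K : Matrix (Fin n) (Fin n) ℂ) :
    ∃ U ∈ Matrix.unitaryGroup (Fin n) ℂ, ∀ i j, j < i → (U * K) i j = 0 := by
  let f : Fin n → EuclideanSpace ℂ (Fin n) := fun j => WithLp.toLp 2 (K.col j)
  let b := InnerProductSpace.gramSchmidtOrthonormalBasis (𝕜 := ℂ) (by simp) f
  refine ⟨_, mem_unitaryGroup_of_orthonormal b.orthonormal, fun i j hij => ?_⟩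
  have h : inner ℂ (b i) (f j) = 0 :=
    InnerProductSpace.gramSchmidtOrthonormalBasis_inv_triangular (by simp) f hij
  simp only [EuclideanSpace.inner_eq_star_dotProduct, dotProduct] at h
  rw [Matrix.mul_apply, ← h]
  refine Finset.sum_congr rfl fun k _ => ?_
  simp [f, mul_comm]

/-- Three matrices with nondegenerate Gram matrix become symmetric after multiplication by a
suitable invertible matrix. -/
theorem exists_mul_symmetric {M : Fin 3 → Matrix (Fin 2) (Fin 2) ℂ} (hM : (gram M).det ≠ 0) :
    ∃ Y : Matrix (Fin 2) (Fin 2) ℂ, Y.det ≠ 0 ∧ ∀ j, (M j * Y) 0 1 = (M j * Y) 1 0 := by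
  let minor : (Fin 3 → ℂ) → (Fin 3 → ℂ) → (Fin 3 → ℂ) → ℂ := fun x y z =>
    x 0 * (y 1 * z 2 - y 2 * z 1) - x 1 * (y 0 * z 2 - y 2 * z 0) + x 2 * (y 0 * z 1 - y 1 * z 0)
  let a : Fin 3 → ℂ := fun j => M j 0 0
  let b : Fin 3 → ℂ := fun j => M j 0 1
  let c : Fin 3 → ℂ := fun j => M j 1 0
  let d : Fin 3 → ℂ := fun j => M j 1 1
  -- Symmetry of all `M j * Y` is three linear equations for the four entries of `Y`; the signed 3×3
  -- minors solve them by Cramer's rule.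
  refine ⟨!![-minor a b d, minor b c d; minor a b c, -minor a c d], fun h => hM ?_, fun j => ?_⟩
  · have : (gram M).det
        = 2 * (!![-minor a b d, minor b c d; minor a b c, -minor a c d] : Matrix _ _ ℂ).det := by
      rw [Matrix.det_fin_three, Matrix.det_fin_two_of]
      simp only [gram, Matrix.of_apply, polarDet_apply, minor, a, b, c, d]
      ring
    rw [this, h, mul_zero]
  · simp only [Matrix.mul_apply, Fin.sum_univ_two, minor, a, b, c, d, Matrix.of_apply,
      Matrix.cons_val', Matrix.cons_val_zero, Matrix.cons_val_one, Matrix.cons_val_fin_one]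
    fin_cases j <;> simp <;> ring

theorem exists_norm_one_mul_eq_norm (z : ℂ) : ∃ ω : ℂ, ‖ω‖ = 1 ∧ ω * z = ‖z‖ := by
  by_cases hz : z = 0
  · exact ⟨1, by simp, by simp [hz]⟩
  · have hn : (‖z‖ : ℂ) ≠ 0 := by simpa using hz
    refine ⟨‖z‖ / z, ?_, div_mul_cancel₀ _ hz⟩
    rw [norm_div, Complex.norm_real, norm_norm, div_self (norm_ne_zero_iff.2 hz)]

theorem lower_mul_symmetric_mul_transpose (a b y p q r : ℂ) :
    !![a, 0; y, b] * !![p, q; q, r] * (!![a, 0; y, b] : Matrix (Fin 2) (Fin 2) ℂ)ᵀ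
      = !![a ^ 2 * p, a * (y * p + b * q); a * (y * p + b * q),
        y ^ 2 * p + 2 * y * b * q + b ^ 2 * r] := by
  ext i k
  simp only [Matrix.mul_apply, Fin.sum_univ_two, Matrix.transpose_apply]
  fin_cases i <;> fin_cases k <;> simp <;> ring

/-- A triangular family of symmetric matrices is congruent, up to phases, to the slices of the
third model space. -/
theorem exists_congruence_triSlices {p q r s t u : ℂ} (hp : p ≠ 0) (hs : s ≠ 0) (hu : u ≠ 0) :
    ∃ (A : Matrix (Fin 2) (Fin 2) ℂ) (e : Fin 3 → ℂ) (d g : ℝ) (h : ℂ),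
      A.det ≠ 0 ∧ (∀ i, ‖e i‖ = 1) ∧ 0 ≤ d ∧ 0 < g ∧
      ∀ j, e j • (A * (![!![p, q; q, r], !![0, s; s, t], !![0, 0; 0, u]] j) * Aᵀ)
        = triSlices d g h j := by
  obtain ⟨ε₀, hε₀, h0⟩ := exists_norm_one_mul_eq_norm p
  -- The matrix `A` eliminates `q` from the first slice, leaving the Schur complement `r - q²/p`.
  -- Its phase is removed by `κ² = ω`, the scales `a, b` normalize `p` and `s`, and the `ε`'s remove
  -- the remaining phases.
  obtain ⟨ω, hω, h1⟩ := exists_norm_one_mul_eq_norm (ε₀ * (r - q ^ 2 / p))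
  obtain ⟨κ, hκ⟩ : ∃ κ : ℂ, κ ^ 2 = ω := IsAlgClosed.exists_pow_nat_eq _ two_pos
  have hκ1 : ‖κ‖ = 1 := by
    have : ‖κ‖ ^ 2 = 1 := by rw [← norm_pow, hκ, hω]
    exact (pow_eq_one_iff_of_nonneg (norm_nonneg _) two_ne_zero).1 this
  obtain ⟨a, ha, ha2⟩ : ∃ a : ℝ, 0 < a ∧ a ^ 2 * ‖p‖ = 1 := by
    have hp' := norm_pos_iff.2 hp
    refine ⟨1 / √‖p‖, by positivity, ?_⟩
    rw [div_pow, Real.sq_sqrt hp'.le]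
    field_simp
  obtain ⟨b, hb, hb2⟩ : ∃ b : ℝ, 0 < b ∧ a * b * ‖s‖ = 1 := by
    have hs' := norm_pos_iff.2 hs
    refine ⟨1 / (a * ‖s‖), by positivity, ?_⟩
    field_simp
  obtain ⟨ε₁, hε₁, h2⟩ := exists_norm_one_mul_eq_norm (κ * s)
  obtain ⟨ε₂, hε₂, h3⟩ := exists_norm_one_mul_eq_norm (κ ^ 2 * u)
  rw [norm_mul, hκ1, one_mul] at h2
  rw [norm_mul, norm_pow, hκ1, one_pow, one_mul] at h3
  have ha2' : (a : ℂ) ^ 2 * ‖p‖ = 1 := by exact_mod_cast congrArg Complex.ofReal ha2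
  have hb2' : (a : ℂ) * b * ‖s‖ = 1 := by exact_mod_cast congrArg Complex.ofReal hb2
  have hac : (a : ℂ) ≠ 0 := by exact_mod_cast ha.ne'
  have hbc : (b : ℂ) ≠ 0 := by exact_mod_cast hb.ne'
  have hκ0 : κ ≠ 0 := by
    rintro rfl
    simp at hκ1
  refine ⟨!![(a : ℂ), 0; -(b * κ * (q / p)), b * κ], ![ε₀, ε₁, ε₂],
    b ^ 2 * ‖ε₀ * (r - q ^ 2 / p)‖, b ^ 2 * ‖u‖, ε₁ * (b * κ) ^ 2 * (t - 2 * (q / p) * s),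
    ?_, fun i => ?_, by positivity, mul_pos (pow_pos hb 2) (norm_pos_iff.2 hu), fun j => ?_⟩
  · rw [Matrix.det_fin_two_of, zero_mul, sub_zero]
    exact mul_ne_zero hac (mul_ne_zero hbc hκ0)
  · fin_cases i <;> simpa
  · have hqp : q / p * p = q := div_mul_cancel₀ _ hp
    have hqp2 : q ^ 2 / p = q / p * q := by ring
    rw [hqp2] at h1 ⊢
    generalize q / p = x at *
    generalize ‖ε₀ * (r - x * q)‖ = n at *
    fin_cases j
    · change ε₀ • (_ * !![p, q; q, r] * _ᵀ) = !![1, 0; 0, _]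
      rw [lower_mul_symmetric_mul_transpose]
      ext i k
      fin_cases i <;> fin_cases k <;> simp
      · linear_combination (a : ℂ) ^ 2 * h0 + ha2'
      · right; right; linear_combination -(b : ℂ) * κ * hqp
      · right; right; linear_combination -(b : ℂ) * κ * hqp
      · linear_combination (b : ℂ) ^ 2 * h1 + (b : ℂ) ^ 2 * ε₀ * (r - x * q) * hκ
          + (b : ℂ) ^ 2 * κ ^ 2 * ε₀ * x * hqp
    · change ε₁ • (_ * !![0, s; s, t] * _ᵀ) = !![0, 1; 1, _]
      rw [lower_mul_symmetric_mul_transpose]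
      ext i k
      fin_cases i <;> fin_cases k <;> simp
      · linear_combination (a : ℂ) * b * h2 + hb2'
      · linear_combination (a : ℂ) * b * h2 + hb2'
      · ring
    · change ε₂ • (_ * !![0, 0; 0, u] * _ᵀ) = !![0, 0; 0, _]
      rw [lower_mul_symmetric_mul_transpose]
      ext i k
      fin_cases i <;> fin_cases k <;> simp
      linear_combination (b : ℂ) ^ 2 * h3

theorem exists_ebConvertible_of_det_ne_zero {M : Fin 3 → Matrix (Fin 2) (Fin 2) ℂ}
    (hEB : IsEB (ofSlices M)) (hM : (gram M).det ≠ 0) :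
    ∃ S, IsModel3 S ∧ EBConvertible S (ofSlices M) := by
  obtain ⟨Y, hY, hsymm⟩ := exists_mul_symmetric hM
  let K : Matrix (Fin 3) (Fin 3) ℂ :=
    Matrix.of fun j => ![(M j * Y) 0 0, (M j * Y) 0 1, (M j * Y) 1 1]
  obtain ⟨U, hU, htri⟩ := exists_unitary_mul_upperTriangular K
  have hK : K.det ≠ 0 := by
    intro h0
    -- In the coordinates `K` of the symmetric matrices `M j * Y` the form `polarDet` has this
    -- matrix; hence `K` is invertible when `gram M` is.
    have h1 : Y.det • gram M = K * !![0, 0, 1; 0, -2, 0; 1, 0, 0] * Kᵀ := by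
      ext i j
      have h2 : Y.det * polarDet (M i) (M j) = polarDet (M i * Y) (M j * Y) := by
        rw [polarDet_apply, polarDet_apply, Matrix.det_fin_two]
        simp only [Matrix.mul_apply, Fin.sum_univ_two]
        ring
      have h3 : (Y.det • gram M) i j = polarDet (M i * Y) (M j * Y) := h2
      rw [h3, polarDet_apply, ← hsymm i, ← hsymm j]
      simp [Matrix.mul_apply (M := K * _), Matrix.mul_apply (M := K), Fin.sum_univ_three, K]
      ring
    have h4 := congrArg Matrix.det h1
    rw [Matrix.det_smul, Matrix.det_mul, Matrix.det_mul, h0, zero_mul, zero_mul] at h4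
    exact mul_ne_zero (pow_ne_zero _ hY) hM h4
  have hUK : (U * K).det = (U * K) 0 0 * (U * K) 1 1 * (U * K) 2 2 := by
    rw [Matrix.det_of_isUpperTriangular (fun i j h => htri i j h), Fin.prod_univ_three]
  have hne : (U * K) 0 0 ≠ 0 ∧ (U * K) 1 1 ≠ 0 ∧ (U * K) 2 2 ≠ 0 := by
    have : (U * K).det ≠ 0 := by
      rw [Matrix.det_mul]
      exact mul_ne_zero (isUnit_det_of_mem_unitaryGroup hU).ne_zero hK
    rw [hUK] at this
    simpa [not_or, and_assoc] using this
  obtain ⟨A, e, d, g, h, hA, he, hd, hg, hN⟩ := exists_congruence_triSlices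
    (q := (U * K) 0 1) (r := (U * K) 0 2) (t := (U * K) 1 2) hne.1 hne.2.1 hne.2.2
  have hmixK : ∀ j, mix U (fun k => M k * Y) j
      = !![(U * K) j 0, (U * K) j 1; (U * K) j 1, (U * K) j 2] := by
    intro j
    ext i k
    rw [mix_apply]
    fin_cases i <;> fin_cases k <;> simp [Matrix.mul_apply (M := U), K, hsymm]
  -- The left factor `A` of the congruence acts on system A, while `Y * Aᵀ` is a mere change of
  -- basis of the subspace.
  have hslices : ∀ j, triSlices d g h j
      = A * mix (Matrix.diagonal e * U) M j * (Y * Aᵀ) := by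
    intro j
    rw [← mix_mix]
    have e1 : ∀ N : Fin 3 → Matrix (Fin 2) (Fin 2) ℂ, mix (Matrix.diagonal e) N j = e j • N j := by
      intro N
      ext i k
      simp [mix_apply, Matrix.diagonal_apply]
    rw [e1, Matrix.mul_smul, Matrix.smul_mul, ← Matrix.mul_assoc, Matrix.mul_assoc A,
      mix_mul, hmixK, ← hN]
    congr 3
    fin_cases j
    · rfl
    · simp [htri 1 0 (by decide)]
    · simp [htri 2 0 (by decide), htri 2 1 (by decide)]
  have hAu : IsUnit A.det := hA.isUnit
  have hV : Matrix.diagonal e * U ∈ Matrix.unitaryGroup (Fin 3) ℂ :=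
    mul_mem (diagonal_mem_unitaryGroup he) hU
  have himg : ofSlices (triSlices d g h) = image A (Matrix.diagonal e * U) (ofSlices M) := by
    rw [image_ofSlices]
    have hYA : IsUnit (Y * Aᵀ).det := by
      rw [Matrix.det_mul, Matrix.det_transpose]
      exact (mul_ne_zero hY hA).isUnit
    refine Eq.trans ?_ (ofSlices_mul _ (Y * Aᵀ) hYA)
    congr 1
    funext j
    exact hslices j
  have hEB' : IsEB (ofSlices (triSlices d g h)) := by
    rw [himg]
    exact hEB.image A hV
  refine ⟨_, isModel3_image_triSlices hd hg hEB', A⁻¹ * inclTwoThreeᵀ,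
    (Matrix.diagonal e * U)⁻¹, inv_mem_unitaryGroup hV, ?_⟩
  rw [image_image, Matrix.mul_assoc, inclTwoThree_transpose_mul, Matrix.mul_one, Matrix.mul_one,
    himg, image_inv_image hAu (isUnit_det_of_mem_unitaryGroup hV)]

theorem isEB_iff_exists_model3 {k : ℕ} (hk : k ≤ 3) {T : Submodule ℂ (Bip 2 k)}
    (hT : Module.finrank ℂ T = 2) : IsEB T ↔
      ∃ S : Submodule ℂ (Bip 3 3), IsModel3 S ∧ EBConvertible S (T.map (embedB hk)) := by
  rw [← isEB_map_embedB hk]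
  rw [← finrank_map_of_injective (embedB_injective hk)] at hT
  generalize T.map (embedB hk) = V at *
  constructor
  · intro hEB
    obtain ⟨M, rfl, -⟩ := exists_eq_ofSlices V hT
    -- For `k = 2` the padded slice is zero, so this space always falls under the singular case.
    by_cases hdet : (gram M).det = 0
    · obtain ⟨U, hU, hU0⟩ := exists_mix_polarDet_eq_zero_of_three (isEB_ofSlices.1 hEB) hdet
      exact exists_ebConvertible_of_product hT hU hU0
    · exact exists_ebConvertible_of_det_ne_zero hEB hdet
  · rintro ⟨S, hS, W, U, hU, rfl⟩
    exact hS.isEB.image W hU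

end EBSpace
theorem mainTheorem3 :
    -- reduction to `ℂ^2 ⊗ ℂ^k` with `k = 2, 3, 4`, where `k` is the local rank on `B`
    (∀ (n : ℕ) (V : Submodule ℂ (EBSpace.Bip 2 n)),
      Module.finrank ℂ V = 2 → EBSpace.IsEB V →
      ∃ k : ℕ, (k = 2 ∨ k = 3 ∨ k = 4) ∧ ∃ (hk : k ≤ n) (T : Submodule ℂ (EBSpace.Bip 2 k)),
        EBSpace.IsEB T ∧ EBSpace.rankB T = k ∧
        EBSpace.LUEquivalent V (T.map (EBSpace.embedB hk))) ∧
    -- `k = 2, 3`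
    (∀ (k : ℕ) (hk : k ≤ 3) (T : Submodule ℂ (EBSpace.Bip 2 k)),
      (k = 2 ∨ k = 3) → Module.finrank ℂ T = 2 →
      (EBSpace.IsEB T ↔
        ∃ S : Submodule ℂ (EBSpace.Bip 3 3), EBSpace.IsModel3 S ∧
          EBSpace.EBConvertible S (T.map (EBSpace.embedB hk)))) ∧
    -- `k = 4`
    (∀ T : Submodule ℂ (EBSpace.Bip 2 4),
      (Module.finrank ℂ T = 2 ∧ EBSpace.IsEB T ∧ EBSpace.rankB T = 4) ↔
        ∃ a b c d : Fin 2 → ℂ,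
          Matrix.det !![a 0 * b 1, a 1 * b 0; c 0 * d 1, c 1 * d 0] ≠ 0 ∧
          EBSpace.EBEquivalent (EBSpace.model4 a b c d) T) := by
  exact ⟨fun _ _ hV hEB => EBSpace.exists_luEquivalent hV hEB,
    fun _ hk _ _ hT => EBSpace.isEB_iff_exists_model3 hk hT,
    EBSpace.isEB_rankB_four_iff⟩
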